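/- Let $k\ge 2$ and $n\ge 1$ be integers and let $\mathcal K_n^{(k)}$ be the complete $k$-uniform hypergraph on $n$ labelled vertices (its hyperedges are all the $k$-element subsets of the vertex set). A cycle in a hypergraph is a sequence $(v_0,e_1,v_1,\dots,e_l,v_l=v_0)$ with $l\ge 2$, where $e_1,\dots,e_l$ are distinct hyperedges, $v_0,\dots,v_{l-1}$ are distinct vertices and $v_{i-1},v_i\in e_i$ for all $i$; a spanning hyperforest of $\mathcal K_n^{(k)}$ is a set $F$ of its hyperedges such that the hypergraph formed by all $n$ vertices and the hyperedges in $F$ has no cycle, and $c(F)$ denotes the number of connected components of that hypergraph (isolated vertices included). Let $$F_n(\lambda;\mathbf e_k)=\sum_{F}\lambda^{c(F)},\qquad \lambda\in\mathbb C,$$ the sum running over all spanning hyperforests $F$ of $\mathcal K_n^{(k)}$, be the generating function of unrooted hyperforests. Let the generalized Hermite polynomials $H_s^{(k)}(x)$ be defined by the (formal) generating function $$\exp\Big[xz+(1-k)\frac{z^k}{k!}\Big]=\sum_{s\ge 0}H_s^{(k)}(x)\,\frac{z^s}{s!}.$$ For $\lambda\in\mathbb C$ let $\lambda^{1/k}$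 be any complex $k$-th root of $\lambda$, and write $\lambda^{j/k}=(\lambda^{1/k})^j$ for integers $j\ge 0$. Then $$F_n(\lambda;\mathbf e_k)=\sum_{\substack{1\le p\le n\\ (k-1)\,\mid\,(n-p)}}\binom{n-1}{p-1}\,\frac{(n-p)!}{\left(\frac{n-p}{k-1}\right)!\,[(k-1)!]^{\frac{n-p}{k-1}}}\;n^{\frac{n-p}{k-1}}\;\lambda^{\frac pk}\,H_p^{(k)}\!\left(\lambda^{\frac{k-1}{k}}\right).$$ Moreover, for $k=2$, for every $\lambda\neq 0$ and either choice of the square root $\sqrt\lambda$, $$F_n(\lambda;\mathbf e_2)=\sqrt\lambda^{\,n}\left[\mathrm{He}_n\!\left(\sqrt\lambda+\frac n{\sqrt\lambda}\right)-\frac n{\sqrt\lambda}\,\mathrm{He}_{n-1}\!\left(\sqrt\lambda+\frac n{\sqrt\lambda}\right)\right],$$ where $\mathrm{He}_s$ are the (monic, "probabilists'") Hermite polynomials. -/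

import Mathlib

open scoped Nat

universe u

/-- A hypergraph with vertex set the (finite) type `V`: a set of hyperedges, each of which is a subset
of `V` with at least two elements (no multiple hyperedges). -/
@[ext]
structure FinHypergraph (V : Type u) where
  edges : Finset (Finset V)
  two_le_card : ∀ A ∈ edges, 2 ≤ A.card

namespace FinHypergraph

variable {V : Type u}

/-- A walk `(v₀, e₁, v₁, …, e_l, v_l)` in a hypergraph: every `e_i` is a hyperedge
that contains both `v_{i-1}` and `v_i`. -/
inductive Walk (G : FinHypergraph V) : V → V → Type u
  | nil (v : V) : Walk G v v
  | cons {x y z : V} (A : Finset V) (hA : A ∈ G.edges) (hx : x ∈ A) (hy : y ∈ A)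
      (p : Walk G y z) : Walk G x z

namespace Walk

variable {G : FinHypergraph V}

/-- The vertices `v₀, …, v_{l-1}` of a walk (all but the last one), in order. -/
def initVertices {x y : V} : Walk G x y → List V
  | nil _ => []
  | cons (x := a) _ _ _ _ p => a :: p.initVertices

/-- The hyperedges `e₁, …, e_l` of a walk, in order. -/
def edgeList {x y : V} : Walk G x y → List (Finset V)
  | nil _ => []
  | cons A _ _ _ p => A :: p.edgeList

/-- The length `l` of a walk. -/
def length {x y : V} : Walk G x y → ℕ
  | nil _ => 0
  | cons _ _ _ _ p => p.length + 1

/-- A cycle is a closed walk of length at least two whose vertices `v₀, …, v_{l-1}` are distinct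
and whose hyperedges `e₁, …, e_l` are distinct. -/
def IsCycle {x : V} (p : Walk G x x) : Prop :=
  p.initVertices.Nodup ∧ p.edgeList.Nodup ∧ 2 ≤ p.length

/-- Concatenation of walks. -/
def append {x y z : V} : Walk G x y → Walk G y z → Walk G x z
  | nil _, q => q
  | cons A hA hx hy p, q => cons A hA hx hy (p.append q)

/-- Reversal of a walk. -/
def reverse {x y : V} : Walk G x y → Walk G y x
  | nil v => nil v
  | cons (x := a) A hA hx hy p => p.reverse.append (cons A hA hy hx (nil a))

end Walk

/-- The equivalence relation on the vertices of being connected by a walk. -/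
def connectedSetoid (G : FinHypergraph V) : Setoid V where
  r x y := Nonempty (G.Walk x y)
  iseqv :=
    { refl := fun x => ⟨Walk.nil x⟩
      symm := fun ⟨p⟩ => ⟨p.reverse⟩
      trans := fun ⟨p⟩ ⟨q⟩ => ⟨p.append q⟩ }

/-- The number of connected components (isolated vertices count as components). -/
noncomputable def numComponents (G : FinHypergraph V) : ℕ :=
  Nat.card (Quotient G.connectedSetoid)

/-- A hyperforest is a hypergraph without cycles. -/
def IsHyperforest (G : FinHypergraph V) : Prop :=
  ∀ (x : V) (p : G.Walk x x), ¬ p.IsCycle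

instance [Finite V] : Finite (FinHypergraph V) :=
  Finite.of_injective (fun G : FinHypergraph V => G.edges) fun _ _ h => FinHypergraph.ext h

/-- The set of spanning hyperforests of `G`: the hyperforests on the whole vertex set all of whose
hyperedges are hyperedges of `G`. -/
noncomputable def spanningHyperforests [Finite V] (G : FinHypergraph V) : Finset (FinHypergraph V) :=
  (Set.toFinite {F : FinHypergraph V | F.edges ⊆ G.edges ∧ F.IsHyperforest}).toFinset

/-- The generating function of the (unrooted) spanning hyperforests of `G`, with a weight `lam`
for each connected component. -/
noncomputable def hyperforestGenFun [Finite V] (G : FinHypergraph V) (lam : ℂ) : ℂ :=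
  ∑ F ∈ G.spanningHyperforests, lam ^ F.numComponents

/-- The complete `k`-uniform hypergraph on `n` vertices, for `k ≥ 2`. -/
def completeUniform (n k : ℕ) (hk : 2 ≤ k) : FinHypergraph (Fin n) where
  edges := Finset.powersetCard k Finset.univ
  two_le_card := fun _ hA => hk.trans_eq (Finset.mem_powersetCard.mp hA).2.symm

end FinHypergraph

/-- The exponent `x z + (1 - k) z ^ k / k!`, a formal power series in `z` whose coefficients are
polynomials in `x`. -/
noncomputable def genHermiteExponent (k : ℕ) : PowerSeries (Polynomial ℚ) :=
  PowerSeries.C Polynomial.X * PowerSeries.X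
    + PowerSeries.C (Polynomial.C ((1 - (k : ℚ)) / (k ! : ℚ))) * PowerSeries.X ^ k

/-- For `k ≥ 2` (indeed `k ≥ 1`) the exponent has no constant term, so it may be substituted. -/
theorem hasSubst_genHermiteExponent {k : ℕ} (hk : 2 ≤ k) :
    PowerSeries.HasSubst (genHermiteExponent k) := by
  apply PowerSeries.HasSubst.of_constantCoeff_zero'
  have : k ≠ 0 := by omega
  simp [genHermiteExponent, this]

/-- The generalized Hermite polynomial `H_s^{(k)}`, defined by the generating function
`exp (x z + (1 - k) z ^ k / k!) = ∑ s, H_s^{(k)}(x) z ^ s / s!`. -/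
noncomputable def genHermite (k s : ℕ) : Polynomial ℚ :=
  (s ! : ℚ) • PowerSeries.coeff s
    ((PowerSeries.exp (Polynomial ℚ)).subst (genHermiteExponent k))

/-! A component `C` of a `k`-uniform hyperforest with `e(C)` hyperedges has `1 + (k - 1) e(C)`
vertices (`card_component`). Hence `1 = ∏ (|C| + (1 - k) e(C))` over the components. Expanding the
product counts unrooted forests by forests in which every component is rooted at a vertex or at a
hyperedge, each hyperedge root weighing `1 - k` (`card_forests_eq_sum_markedForests`).

Deleting a root hyperedge leaves `k` components, each rooted at its vertex on that hyperedge. So a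
forest with `i` vertex roots and `j` hyperedge roots is a forest with `s = i + k j` vertex roots, `k
j` of which are grouped into `j` unordered blocks of size `k` (`markedForests_mul`). The number of
groupings, times `(1 - k) ^ j`, is the coefficient of `x ^ i` in `H_s^{(k)}`, read off from its
generating function (`genHermite_eq_sum`).

What remains is the number of vertex-rooted forests with `s` components. Deleting an arbitrary
hyperedge gives a recursion in `s` that starts at the empty forest (`sub_mul_markedForests_zero`,
`markedForests_zero_mul`). For `k = 2` the sum collapses by the Appell identity for Hermite
polynomials and Pascal's rule. -/

namespace FinHypergraph

/-! ### Walks, linkage and acyclicity -/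

section WalkLemmas

variable {V : Type*} {G : FinHypergraph V}

namespace Walk

/-- From every vertex of a walk, the end of the walk is at most as far as from its start. -/
theorem exists_walk_of_mem_initVertices {x z : V} (p : Walk G x z) {w : V}
    (hw : w ∈ p.initVertices) : ∃ q : Walk G w z, q.length ≤ p.length := by
  induction p with
  | nil v => simp [initVertices] at hw
  | cons A hA hx hy p ih =>
    simp only [initVertices, List.mem_cons] at hw
    rcases hw with rfl | hw
    · exact ⟨cons A hA hx hy p, le_rfl⟩
    · obtain ⟨q, hq⟩ := ih hw
      exact ⟨q, hq.trans (Nat.le_succ _)⟩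

theorem exists_walk_of_mem_edgeList {x z : V} (p : Walk G x z) {B : Finset V}
    (hB : B ∈ p.edgeList) {w : V} (hw : w ∈ B) : ∃ q : Walk G w z, q.length ≤ p.length := by
  induction p with
  | nil v => simp [edgeList] at hB
  | cons A hA hx hy p ih =>
    simp only [edgeList, List.mem_cons] at hB
    rcases hB with rfl | hB
    · exact ⟨cons B hA hw hy p, le_rfl⟩
    · obtain ⟨q, hq⟩ := ih hB
      exact ⟨q, hq.trans (Nat.le_succ _)⟩

/-- A geodesic walk repeats neither vertices nor hyperedges. -/
theorem nodup_of_geodesic {x z : V} (p : Walk G x z)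
    (hp : ∀ q : Walk G x z, p.length ≤ q.length) :
    p.initVertices.Nodup ∧ z ∉ p.initVertices ∧ p.edgeList.Nodup := by
  induction p with
  | nil v => simp [initVertices, edgeList]
  | @cons x y z A hA hx hy p ih =>
    have hlt : ∀ q : Walk G x z, ¬ q.length ≤ p.length := fun q hq => by
      have := hp q
      simp only [length] at this
      omega
    obtain ⟨h1, h2, h3⟩ := ih fun q => by
      have := hp (cons A hA hx hy q)
      simpa only [length, Nat.add_le_add_iff_right] using this
    refine ⟨List.nodup_cons.2 ⟨fun h => ?_, h1⟩, ?_, List.nodup_cons.2 ⟨fun h => ?_, h3⟩⟩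
    · obtain ⟨q, hq⟩ := p.exists_walk_of_mem_initVertices h
      exact hlt q hq
    · simp only [initVertices, List.mem_cons, not_or]
      refine ⟨?_, h2⟩
      rintro rfl
      exact hlt (nil z) (Nat.zero_le _)
    -- If `A` recurs in `p`, then `x ∈ A` can join `p` at the later occurrence, which is a shortcut.
    · obtain ⟨q, hq⟩ := p.exists_walk_of_mem_edgeList h hx
      exact hlt q hq

end Walk

end WalkLemmas

/-- Two vertices are linked by a set of hyperedges if they are joined by a chain of hyperedges. -/
def Linked {V : Type*} (E : Finset (Finset V)) : V → V → Prop :=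
  Relation.ReflTransGen fun x y => ∃ A ∈ E, x ∈ A ∧ y ∈ A

section Linked

variable {V : Type*} {E E' : Finset (Finset V)} {e : Finset V} {x y z : V}

theorem Linked.refl (x : V) : Linked E x x := Relation.ReflTransGen.refl

theorem Linked.trans (h : Linked E x y) (h' : Linked E y z) : Linked E x z :=
  Relation.ReflTransGen.trans h h'


theorem Linked.of_mem (he : e ∈ E) (hx : x ∈ e) (hy : y ∈ e) : Linked E x y :=
  Relation.ReflTransGen.single ⟨e, he, hx, hy⟩

theorem Linked.symm (h : Linked E x y) : Linked E y x := by
  induction h with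
  | refl => exact Linked.refl x
  | tail _ h ih =>
    obtain ⟨A, hA, hy, hz⟩ := h
    exact (Linked.of_mem hA hz hy).trans ih

theorem Linked.mono (hE : E ⊆ E') (h : Linked E x y) : Linked E' x y := by
  induction h with
  | refl => exact Linked.refl x
  | tail _ h ih =>
    obtain ⟨A, hA, hy, hz⟩ := h
    exact ih.trans (Linked.of_mem (hE hA) hy hz)

theorem nonempty_walk_iff_linked {G : FinHypergraph V} :
    Nonempty (G.Walk x y) ↔ Linked G.edges x y := by
  constructor
  · rintro ⟨p⟩
    induction p with
    | nil v => exact Linked.refl v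
    | cons A hA hx hy p ih => exact (Linked.of_mem hA hx hy).trans ih
  · intro h
    induction h using Relation.ReflTransGen.head_induction_on with
    | refl => exact ⟨Walk.nil y⟩
    | head h _ ih =>
      obtain ⟨A, hA, hx, hy⟩ := h
      exact ih.elim fun p => ⟨Walk.cons A hA hx hy p⟩

/-- A set of vertices is transverse to a set of hyperedges if it has at most one vertex in each
component. -/
def Transverse (E : Finset (Finset V)) (e : Finset V) : Prop :=
  ∀ x ∈ e, ∀ y ∈ e, Linked E x y → x = y

theorem Transverse.notMem (h : Transverse E e) (he : 2 ≤ e.card) : e ∉ E := fun hE => by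
  obtain ⟨x, hx, y, hy, hxy⟩ := Finset.one_lt_card.1 he
  exact hxy (h x hx y hy (Linked.of_mem hE hx hy))

/-- Walks in a hypergraph are walks in any hypergraph with more hyperedges. -/
def Walk.mapSubset {G G' : FinHypergraph V} (h : G.edges ⊆ G'.edges) {x y : V} :
    G.Walk x y → G'.Walk x y
  | nil v => nil v
  | cons A hA hx hy p => cons A (h hA) hx hy (p.mapSubset h)

theorem Walk.initVertices_mapSubset {G G' : FinHypergraph V} (h : G.edges ⊆ G'.edges)
    (p : G.Walk x y) : (p.mapSubset h).initVertices = p.initVertices := by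
  induction p with
  | nil v => rfl
  | cons A hA hx hy p ih => simp [mapSubset, initVertices, ih]

theorem Walk.edgeList_mapSubset {G G' : FinHypergraph V} (h : G.edges ⊆ G'.edges)
    (p : G.Walk x y) : (p.mapSubset h).edgeList = p.edgeList := by
  induction p with
  | nil v => rfl
  | cons A hA hx hy p ih => simp [mapSubset, edgeList, ih]

theorem Walk.mem_edges_of_mem_edgeList {G : FinHypergraph V} (p : G.Walk x y)
    (he : e ∈ p.edgeList) : e ∈ G.edges := by
  induction p with
  | nil v => simp [edgeList] at he
  | cons A hA hx hy p ih =>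
    simp only [edgeList, List.mem_cons] at he
    rcases he with rfl | he
    · exact hA
    · exact ih he

variable [DecidableEq V]

/-- A chain that uses `e` several times can be cut from its first entry `u` into `e` to its last
exit `v`, so `e` is needed at most once. -/
theorem linked_insert_iff :
    Linked (insert e E) x y ↔
      Linked E x y ∨ ∃ u ∈ e, ∃ v ∈ e, Linked E x u ∧ Linked E v y := by
  constructor
  · intro h
    induction h with
    | refl => exact Or.inl (Linked.refl x)
    | tail _ h ih =>
      obtain ⟨A, hA, hy, hz⟩ := h
      rcases Finset.mem_insert.1 hA with rfl | hA
      · rcases ih with ih | ⟨u, hu, v, hv, h1, h2⟩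
        · exact Or.inr ⟨_, hy, _, hz, ih, Linked.refl _⟩
        · exact Or.inr ⟨_, hu, _, hz, h1, Linked.refl _⟩
      · rcases ih with ih | ⟨u, hu, v, hv, h1, h2⟩
        · exact Or.inl (ih.trans (Linked.of_mem hA hy hz))
        · exact Or.inr ⟨u, hu, v, hv, h1, h2.trans (Linked.of_mem hA hy hz)⟩
  · have hE : E ⊆ insert e E := Finset.subset_insert e E
    rintro (h | ⟨u, hu, v, hv, h1, h2⟩)
    · exact h.mono hE
    · exact ((h1.mono hE).trans (Linked.of_mem (Finset.mem_insert_self e E) hu hv)).trans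
        (h2.mono hE)

/-- A set of hyperedges is acyclic if no hyperedge contains two distinct vertices that are linked
by the other hyperedges. -/
def Acyclic (E : Finset (Finset V)) : Prop :=
  ∀ e ∈ E, ∀ x ∈ e, ∀ y ∈ e, Linked (E.erase e) x y → x = y

/-- This allows induction on hyperedges. If a link between `x, y ∈ f` avoiding `f` enters `e` at `u`
and leaves it at `v`, then `u` and `v` are already linked in `E` through `f`. Transversality gives
`u = v`, and the detour through `e` can be dropped. -/
theorem acyclic_insert_iff (he : e ∉ E) :
    Acyclic (insert e E) ↔ Acyclic E ∧ Transverse E e := by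
  constructor
  · intro h
    refine ⟨fun f hf x hx y hy hxy => ?_, fun x hx y hy hxy => ?_⟩
    · exact h f (Finset.mem_insert_of_mem hf) x hx y hy
        (hxy.mono (Finset.erase_subset_erase _ (Finset.subset_insert e E)))
    · refine h e (Finset.mem_insert_self e E) x hx y hy ?_
      rwa [Finset.erase_insert he]
  · rintro ⟨h, ht⟩ f hf x hx y hy hxy
    rcases Finset.mem_insert.1 hf with rfl | hfE
    · rw [Finset.erase_insert he] at hxy
      exact ht x hx y hy hxy
    · have hne : e ≠ f := fun hef => he (hef ▸ hfE)
      rw [Finset.erase_insert_of_ne hne, linked_insert_iff] at hxy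
      rcases hxy with hxy | ⟨u, hu, v, hv, hxu, hvy⟩
      · exact h f hfE x hx y hy hxy
      · have hE : E.erase f ⊆ E := Finset.erase_subset f E
        have huv : u = v := ht u hu v hv
          (((hxu.mono hE).symm.trans (Linked.of_mem hfE hx hy)).trans (hvy.mono hE).symm)
        subst huv
        exact h f hfE x hx y hy (hxu.trans hvy)

theorem linked_erase_of_walk {G : FinHypergraph V} (p : G.Walk x y) (he : e ∉ p.edgeList) :
    Linked (G.edges.erase e) x y := by
  induction p with
  | nil v => exact Linked.refl v
  | cons A hA hx hy p ih =>
    simp only [Walk.edgeList, List.mem_cons, not_or] at he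
    exact (Linked.of_mem (Finset.mem_erase.2 ⟨Ne.symm he.1, hA⟩) hx hy).trans (ih he.2)

/-- A shortest link avoiding `e` between two vertices of `e` closes up with `e` to a cycle; being
shortest makes its vertices and hyperedges distinct. Conversely, a cycle without its first hyperedge
links two vertices of that hyperedge. -/
theorem isHyperforest_iff_acyclic {G : FinHypergraph V} :
    G.IsHyperforest ↔ Acyclic G.edges := by
  constructor
  · intro h e he x hx y hy hxy
    by_contra hne
    let G' : FinHypergraph V :=
      ⟨G.edges.erase e, fun A hA => G.two_le_card A (Finset.mem_of_mem_erase hA)⟩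
    have hne' : Nonempty (G'.Walk x y) := nonempty_walk_iff_linked.2 hxy
    obtain ⟨p, hp⟩ : ∃ p : G'.Walk x y, ∀ q : G'.Walk x y, p.length ≤ q.length :=
      ⟨Function.argmin Walk.length, fun q => Function.argmin_le Walk.length q⟩
    obtain ⟨h1, h2, h3⟩ := p.nodup_of_geodesic hp
    have hG : G'.edges ⊆ G.edges := Finset.erase_subset e G.edges
    refine h y (Walk.cons e he hy hx (p.mapSubset hG)) ⟨?_, ?_, ?_⟩
    · simp only [Walk.initVertices, Walk.initVertices_mapSubset]
      exact List.nodup_cons.2 ⟨h2, h1⟩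
    · simp only [Walk.edgeList, Walk.edgeList_mapSubset]
      exact List.nodup_cons.2
        ⟨fun hmem => Finset.notMem_erase e G.edges (p.mem_edges_of_mem_edgeList hmem), h3⟩
    · cases p with
      | nil v => exact absurd rfl hne
      | cons A hA hx hy p => simp [Walk.mapSubset, Walk.length]
  · rintro h x p ⟨h1, h2, h3⟩
    cases p with
    | nil v => simp [Walk.length] at h3
    | @cons _ y _ A hA hx hy p =>
      simp only [Walk.edgeList, List.nodup_cons] at h2
      have hxy := h A hA y hy x hx (linked_erase_of_walk p h2.1)
      subst hxy
      cases p with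
      | nil v => simp [Walk.length] at h3
      | cons B hB hy' hz p => simp [Walk.initVertices] at h1

end Linked

end FinHypergraph

/-! ### Mixed elementary symmetric sums -/

section MixedSum

variable {ι R : Type*} [DecidableEq ι] [CommRing R]

theorem Finset.sum_powersetCard_succ_sum_mem {M : Type*} [AddCommMonoid M] (s : Finset ι) (j : ℕ)
    (f : Finset ι → ι → M) :
    ∑ J ∈ s.powersetCard (j + 1), ∑ i ∈ J, f J i =
      ∑ i ∈ s, ∑ K ∈ (s.erase i).powersetCard j, f (insert i K) i := by
  rw [Finset.sum_sigma', Finset.sum_sigma']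
  refine Finset.sum_bij' (fun p _ => ⟨p.2, p.1.erase p.2⟩) (fun p _ => ⟨insert p.1 p.2, p.1⟩)
    ?_ ?_ ?_ ?_ ?_
  · rintro ⟨J, i⟩ h
    simp only [Finset.mem_sigma, Finset.mem_powersetCard] at h ⊢
    obtain ⟨⟨hJ, hc⟩, hi⟩ := h
    refine ⟨hJ hi, Finset.erase_subset_erase i hJ, ?_⟩
    rw [Finset.card_erase_of_mem hi, hc, Nat.add_sub_cancel]
  · rintro ⟨i, K⟩ h
    simp only [Finset.mem_sigma, Finset.mem_powersetCard] at h ⊢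
    obtain ⟨hi, hK, hc⟩ := h
    have hiK : i ∉ K := fun h => Finset.notMem_erase i s (hK h)
    refine ⟨⟨Finset.insert_subset hi (hK.trans (Finset.erase_subset i s)), ?_⟩,
      Finset.mem_insert_self i K⟩
    rw [Finset.card_insert_of_notMem hiK, hc]
  · rintro ⟨J, i⟩ h
    simp only [Finset.mem_sigma] at h
    simp [Finset.insert_erase h.2]
  · rintro ⟨i, K⟩ h
    simp only [Finset.mem_sigma, Finset.mem_powersetCard] at h
    have hiK : i ∉ K := fun hm => Finset.notMem_erase i s (h.2.1 hm)
    simp [Finset.erase_insert hiK]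
  · rintro ⟨J, i⟩ h
    simp only [Finset.mem_sigma] at h
    simp [Finset.insert_erase h.2]

theorem Finset.sum_powersetCard_sum_mem_apply (s : Finset ι) (j : ℕ) (a : ι → R) :
    ∑ J ∈ s.powersetCard (j + 1), ∑ i ∈ J, a i = (s.card - 1).choose j * ∑ i ∈ s, a i := by
  rw [Finset.sum_powersetCard_succ_sum_mem s j fun _ i => a i, Finset.mul_sum]
  refine Finset.sum_congr rfl fun i hi => ?_
  rw [Finset.sum_const, Finset.card_powersetCard, Finset.card_erase_of_mem hi, nsmul_eq_mul]

/-- The coefficient of `y ^ j` in `∏ i ∈ s, (a i + y * b i)`. -/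
def mixedSum (a b : ι → R) (j : ℕ) (s : Finset ι) : R :=
  ∑ J ∈ s.powersetCard j, (∏ i ∈ J, b i) * ∏ i ∈ s \ J, a i

theorem mixedSum_zero (a b : ι → R) (s : Finset ι) : mixedSum a b 0 s = ∏ i ∈ s, a i := by
  simp [mixedSum]

theorem mixedSum_congr {a b a' b' : ι → R} {j : ℕ} {s : Finset ι} (ha : ∀ i ∈ s, a i = a' i)
    (hb : ∀ i ∈ s, b i = b' i) : mixedSum a b j s = mixedSum a' b' j s := by
  refine Finset.sum_congr rfl fun J hJ => ?_
  have hJ := (Finset.mem_powersetCard.1 hJ).1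
  rw [Finset.prod_congr rfl fun i hi => hb i (hJ hi),
    Finset.prod_congr rfl fun i hi => ha i (Finset.sdiff_subset hi)]

theorem prod_add_mul_eq_sum_mixedSum (a b : ι → R) (y : R) (s : Finset ι) :
    ∏ i ∈ s, (a i + y * b i) = ∑ j ∈ Finset.range (s.card + 1), y ^ j * mixedSum a b j s := by
  simp_rw [add_comm (a _)]
  rw [Finset.prod_add, Finset.sum_powerset]
  refine Finset.sum_congr rfl fun j _ => ?_
  rw [mixedSum, Finset.mul_sum]
  refine Finset.sum_congr rfl fun J hJ => ?_
  rw [Finset.prod_mul_distrib, Finset.prod_const, (Finset.mem_powersetCard.1 hJ).2, mul_assoc]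

/-- Each term has `j + 1` factors from `b`; one of them is singled out. -/
theorem succ_mul_mixedSum_succ (a b : ι → R) (j : ℕ) (s : Finset ι) :
    ((j + 1 : ℕ) : R) * mixedSum a b (j + 1) s = ∑ i ∈ s, b i * mixedSum a b j (s.erase i) := by
  have h1 : ((j + 1 : ℕ) : R) * mixedSum a b (j + 1) s =
      ∑ J ∈ s.powersetCard (j + 1), ∑ _i ∈ J, (∏ i ∈ J, b i) * ∏ i ∈ s \ J, a i := by
    rw [mixedSum, Finset.mul_sum]
    refine Finset.sum_congr rfl fun J hJ => ?_
    rw [Finset.sum_const, (Finset.mem_powersetCard.1 hJ).2, nsmul_eq_mul]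
  rw [h1, Finset.sum_powersetCard_succ_sum_mem s j
    fun J _ => (∏ i ∈ J, b i) * ∏ i ∈ s \ J, a i]
  refine Finset.sum_congr rfl fun i hi => ?_
  rw [mixedSum, Finset.mul_sum]
  refine Finset.sum_congr rfl fun K hK => ?_
  have hiK : i ∉ K := fun h => Finset.notMem_erase i s ((Finset.mem_powersetCard.1 hK).1 h)
  rw [Finset.prod_insert hiK, mul_assoc, Finset.sdiff_insert, Finset.erase_sdiff_comm]

/-- Each term of `mixedSum a b j s` arises once for every choice of `k` among its `s.card - j`
factors from `a`. In the application these are `k` vertex-rooted components about to be joined by a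
hyperedge. -/
theorem sum_powersetCard_prod_mul_mixedSum (a b : ι → R) (j k : ℕ) (s : Finset ι) :
    ∑ S ∈ s.powersetCard k, (∏ i ∈ S, a i) * mixedSum a b j (s \ S) =
      (s.card - j).choose k * mixedSum a b j s := by
  simp_rw [mixedSum, Finset.mul_sum]
  rw [Finset.sum_comm' (t' := s.powersetCard j) (s' := fun J => (s \ J).powersetCard k)]
  · refine Finset.sum_congr rfl fun J hJ => ?_
    obtain ⟨hJs, hJc⟩ := Finset.mem_powersetCard.1 hJ
    have hterm : ∀ S ∈ (s \ J).powersetCard k,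
        (∏ i ∈ S, a i) * ((∏ i ∈ J, b i) * ∏ i ∈ (s \ S) \ J, a i) =
          (∏ i ∈ J, b i) * ∏ i ∈ s \ J, a i := fun S hS => by
      rw [← Finset.prod_sdiff (Finset.mem_powersetCard.1 hS).1, sdiff_right_comm]
      ring
    rw [Finset.sum_congr rfl hterm, Finset.sum_const, Finset.card_powersetCard,
      Finset.card_sdiff_of_subset hJs, hJc, nsmul_eq_mul]
  · intro S J
    simp only [Finset.mem_powersetCard, Finset.subset_sdiff]
    constructor
    · rintro ⟨⟨h1, h2⟩, ⟨h3, h4⟩, h5⟩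
      exact ⟨⟨⟨h1, h4.symm⟩, h2⟩, h3, h5⟩
    · rintro ⟨⟨⟨h1, h4⟩, h2⟩, h3, h5⟩
      exact ⟨⟨h1, h2⟩, ⟨h3, h4.symm⟩, h5⟩

end MixedSum

/-! ### Transversals of a partition -/

section Transversals

variable {V : Type*} [DecidableEq V] {s : Finset V}

/-- The parts of a finpartition that meet a given set. -/
def Finpartition.partsMeeting (P : Finpartition s) (e : Finset V) : Finset (Finset V) :=
  P.parts.filter fun C => ¬ Disjoint C e

/-- The parts of a finpartition that avoid a given set. -/
def Finpartition.partsAvoiding (P : Finpartition s) (e : Finset V) : Finset (Finset V) :=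
  P.parts.filter fun C => Disjoint C e

/-- A set has at most one point in each part of a finpartition. -/
def Finpartition.SeparatesPoints (P : Finpartition s) (e : Finset V) : Prop :=
  ∀ x ∈ e, ∀ y ∈ e, P.part x = P.part y → x = y

instance (P : Finpartition s) : DecidablePred P.SeparatesPoints := fun e =>
  inferInstanceAs (Decidable (∀ x ∈ e, ∀ y ∈ e, P.part x = P.part y → x = y))

namespace Finpartition

variable (P : Finpartition s)

theorem parts_sdiff_partsMeeting (e : Finset V) :
    P.parts \ P.partsMeeting e = P.partsAvoiding e := by
  ext C
  simp only [partsMeeting, partsAvoiding, Finset.mem_sdiff, Finset.mem_filter]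
  tauto

theorem partsMeeting_eq_image {e : Finset V} (he : e ⊆ s) :
    P.partsMeeting e = e.image P.part := by
  ext C
  simp only [partsMeeting, Finset.mem_filter, Finset.mem_image, Finset.not_disjoint_iff]
  constructor
  · rintro ⟨hC, v, hvC, hve⟩
    exact ⟨v, hve, P.part_eq_of_mem hC hvC⟩
  · rintro ⟨v, hve, rfl⟩
    exact ⟨P.part_mem.2 (he hve), v, P.mem_part_self.2 (he hve), hve⟩

/-- The number of partial transversals of a finpartition that meet a prescribed set of parts. -/
theorem card_transversals {S : Finset (Finset V)} (hS : S ⊆ P.parts) :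
    (s.powerset.filter fun e => P.SeparatesPoints e ∧ P.partsMeeting e = S).card =
      ∏ C ∈ S, C.card := by
  rw [← Finset.card_pi S fun C => C]
  symm
  have hpart : ∀ (f : ∀ C ∈ S, V), f ∈ S.pi (fun C => C) → ∀ (C : Finset V) (hC : C ∈ S),
      P.part (f C hC) = C := fun f hf C hC =>
    P.part_eq_of_mem (hS hC) (Finset.mem_pi.1 hf C hC)
  -- A choice of one point per part is recovered from its set of values, since the parts are
  -- disjoint.
  refine Finset.card_bij (fun f _ => S.attach.image fun C => f C.1 C.2) ?_ ?_ ?_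
  · intro f hf
    have hsub : (S.attach.image fun C => f C.1 C.2) ⊆ s := by
      intro v hv
      obtain ⟨C, -, rfl⟩ := Finset.mem_image.1 hv
      exact P.subset (hS C.2) (Finset.mem_pi.1 hf C.1 C.2)
    refine Finset.mem_filter.2 ⟨Finset.mem_powerset.2 hsub, ?_, ?_⟩
    · intro v hv w hw hvw
      obtain ⟨⟨C, hC⟩, -, rfl⟩ := Finset.mem_image.1 hv
      obtain ⟨⟨D, hD⟩, -, rfl⟩ := Finset.mem_image.1 hw
      simp only [hpart f hf] at hvw
      subst hvw
      rfl
    · rw [P.partsMeeting_eq_image hsub, Finset.image_image]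
      conv_rhs => rw [← Finset.attach_image_val (s := S)]
      exact Finset.image_congr fun C _ => hpart f hf C.1 C.2
  · intro f hf g hg hfg
    funext C hC
    have hmem : f C hC ∈ S.attach.image fun C => g C.1 C.2 := by
      rw [← hfg]
      exact Finset.mem_image.2 ⟨⟨C, hC⟩, Finset.mem_attach _ _, rfl⟩
    obtain ⟨⟨D, hD⟩, -, h⟩ := Finset.mem_image.1 hmem
    have hDC : D = C := by rw [← hpart f hf C hC, ← hpart g hg D hD, ← h]
    subst hDC
    exact h.symm
  · intro e he
    obtain ⟨hes, hinj, hm⟩ := Finset.mem_filter.1 he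
    have hes := Finset.mem_powerset.1 hes
    rw [P.partsMeeting_eq_image hes] at hm
    have hex : ∀ C ∈ S, ∃ v ∈ e, P.part v = C := fun C hC => by
      rw [← hm] at hC
      exact Finset.mem_image.1 hC
    choose f hfe hfC using hex
    refine ⟨f, Finset.mem_pi.2 fun C hC => ?_, ?_⟩
    · have := P.mem_part_self.2 (hes (hfe C hC))
      rwa [hfC] at this
    · ext v
      simp only [Finset.mem_image, Finset.mem_attach, true_and, Subtype.exists]
      constructor
      · rintro ⟨C, hC, rfl⟩
        exact hfe C hC
      · intro hv
        have hC : P.part v ∈ S := hm ▸ Finset.mem_image_of_mem _ hv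
        exact ⟨P.part v, hC, hinj _ (hfe _ hC) v hv (hfC _ hC)⟩

/-- Transversal `k`-sets are grouped by the parts they meet. This turns sums over addable hyperedges
into sums over `k`-sets of components, weighted by the product of their sizes. -/
theorem sum_transversals {R : Type*} [CommRing R] (k : ℕ) (g : Finset (Finset V) → R) :
    ∑ e ∈ (s.powersetCard k).filter (fun e => P.SeparatesPoints e),
        g (P.partsMeeting e) =
      ∑ S ∈ P.parts.powersetCard k, (∏ C ∈ S, (C.card : R)) * g S := by
  have hmaps : ∀ e ∈ (s.powersetCard k).filter (fun e => P.SeparatesPoints e),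
      P.partsMeeting e ∈ P.parts.powersetCard k := fun e he => by
    obtain ⟨he, hinj⟩ := Finset.mem_filter.1 he
    obtain ⟨hes, hec⟩ := Finset.mem_powersetCard.1 he
    refine Finset.mem_powersetCard.2 ⟨Finset.filter_subset _ _, ?_⟩
    rw [P.partsMeeting_eq_image hes,
      Finset.card_image_of_injOn fun x hx y hy => hinj x hx y hy, hec]
  rw [← Finset.sum_fiberwise_of_maps_to hmaps]
  refine Finset.sum_congr rfl fun S hS => ?_
  obtain ⟨hSP, hSc⟩ := Finset.mem_powersetCard.1 hS
  have hfib : ((s.powersetCard k).filter fun e => P.SeparatesPoints e).filter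
      (fun e => P.partsMeeting e = S) =
      s.powerset.filter fun e => P.SeparatesPoints e ∧ P.partsMeeting e = S := by
    ext e
    simp only [Finset.mem_filter, Finset.mem_powersetCard, Finset.mem_powerset]
    constructor
    · rintro ⟨⟨⟨h1, -⟩, h2⟩, h3⟩
      exact ⟨h1, h2, h3⟩
    · rintro ⟨h1, h2, h3⟩
      refine ⟨⟨⟨h1, ?_⟩, h2⟩, h3⟩
      rw [← hSc, ← h3, P.partsMeeting_eq_image h1,
        Finset.card_image_of_injOn fun x hx y hy => h2 x hx y hy]
  rw [Finset.sum_congr rfl fun e he => by rw [(Finset.mem_filter.1 he).2], Finset.sum_const,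
    hfib, P.card_transversals hSP, nsmul_eq_mul, Nat.cast_prod]

end Finpartition

end Transversals

/-! ### Components, and the effect of adding a hyperedge -/

namespace Finpartition

variable {V : Type*} [DecidableEq V] {s : Finset V}

theorem sum_parts_eq_add {M : Type*} [AddCommMonoid M] (P : Finpartition s) (e : Finset V)
    (f : Finset V → M) :
    ∑ C ∈ P.parts, f C = ∑ C ∈ P.partsMeeting e, f C + ∑ C ∈ P.partsAvoiding e, f C := by
  rw [add_comm]
  exact (Finset.sum_filter_add_sum_filter_not P.parts (fun C => Disjoint C e) f).symm

theorem prod_parts_eq_mul {M : Type*} [CommMonoid M] (P : Finpartition s) (e : Finset V)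
    (f : Finset V → M) :
    ∏ C ∈ P.parts, f C = (∏ C ∈ P.partsMeeting e, f C) * ∏ C ∈ P.partsAvoiding e, f C := by
  rw [mul_comm]
  exact (Finset.prod_filter_mul_prod_filter_not P.parts (fun C => Disjoint C e) f).symm

end Finpartition

namespace FinHypergraph

variable {V : Type*} {E : Finset (Finset V)} {e : Finset V} {x y : V}

theorem linked_empty_iff : Linked (∅ : Finset (Finset V)) x y ↔ x = y := by
  refine ⟨fun h => ?_, fun h => h ▸ Linked.refl x⟩
  induction h with
  | refl => rfl
  | tail _ h _ =>
    obtain ⟨A, hA, -⟩ := h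
    exact absurd hA (Finset.notMem_empty A)

/-- The number of hyperedges contained in a given set of vertices. -/
def edgesIn [DecidableEq V] (E : Finset (Finset V)) (C : Finset V) : ℕ :=
  (E.filter fun f => f ⊆ C).card

theorem edgesIn_insert_of_disjoint [DecidableEq V] (hne : e.Nonempty) {C : Finset V}
    (hC : Disjoint C e) :
    edgesIn (insert e E) C = edgesIn E C := by
  rw [edgesIn, edgesIn, Finset.filter_insert, if_neg]
  obtain ⟨x, hx⟩ := hne
  exact fun h => Finset.disjoint_left.1 hC (h hx) hx

variable [Fintype V] [DecidableEq V]

/-- The equivalence relation of being linked by a set of hyperedges. -/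
def linkedSetoid (E : Finset (Finset V)) : Setoid V :=
  ⟨Linked E, Linked.refl, Linked.symm, Linked.trans⟩

open Classical in
/-- The partition of the vertices into the components of a set of hyperedges. -/
noncomputable def components (E : Finset (Finset V)) : Finpartition (Finset.univ : Finset V) :=
  Finpartition.ofSetoid (linkedSetoid E)

theorem mem_part_components : y ∈ (components E).part x ↔ Linked E x y := by
  classical
  exact Finpartition.mem_part_ofSetoid_iff_rel

theorem part_components_eq_iff :
    (components E).part x = (components E).part y ↔ Linked E x y := by
  rw [eq_comm, ← Finpartition.mem_part_iff_part_eq_part _ (Finset.mem_univ _) (Finset.mem_univ _),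
    mem_part_components]

theorem separatesPoints_components_iff :
    (components E).SeparatesPoints e ↔ Transverse E e := by
  simp only [Finpartition.SeparatesPoints, Transverse, part_components_eq_iff]

theorem part_components_mem (E : Finset (Finset V)) (x : V) :
    (components E).part x ∈ (components E).parts :=
  (Finpartition.part_mem _).2 (Finset.mem_univ x)

theorem exists_part_eq {C : Finset V} (hC : C ∈ (components E).parts) :
    ∃ x ∈ C, (components E).part x = C := by
  obtain ⟨x, hx⟩ := (components E).nonempty_of_mem_parts hC
  exact ⟨x, hx, (components E).part_eq_of_mem hC hx⟩

theorem disjoint_part_components_iff :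
    Disjoint ((components E).part x) e ↔ ∀ u ∈ e, ¬ Linked E x u := by
  rw [Finset.disjoint_right]
  exact forall₂_congr fun u _ => by rw [mem_part_components]

theorem disjoint_part_components_insert_iff :
    Disjoint ((components (insert e E)).part x) e ↔ Disjoint ((components E).part x) e := by
  rw [disjoint_part_components_iff, disjoint_part_components_iff]
  constructor
  · exact fun h u hu hxu => h u hu (hxu.mono (Finset.subset_insert e E))
  · intro h u hu hxu
    rcases linked_insert_iff.1 hxu with hxu | ⟨v, hv, -, -, hxv, -⟩
    · exact h u hu hxu
    · exact h v hv hxv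

theorem part_components_insert_of_disjoint (h : Disjoint ((components E).part x) e) :
    (components (insert e E)).part x = (components E).part x := by
  rw [disjoint_part_components_iff] at h
  ext y
  rw [mem_part_components, mem_part_components, linked_insert_iff]
  refine or_iff_left ?_
  rintro ⟨u, hu, -, -, hxu, -⟩
  exact h u hu hxu

/-- Adding `e` fuses the components it meets and leaves all others untouched. The counts below
compare the two partitions by cancelling these common parts. -/
theorem partsAvoiding_components_insert (e : Finset V) (E : Finset (Finset V)) :
    (components (insert e E)).partsAvoiding e = (components E).partsAvoiding e := by
  ext C
  simp only [Finpartition.partsAvoiding, Finset.mem_filter]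
  constructor
  · rintro ⟨hC, hd⟩
    obtain ⟨x, -, rfl⟩ := exists_part_eq hC
    have hd' := disjoint_part_components_insert_iff.1 hd
    rw [part_components_insert_of_disjoint hd']
    exact ⟨part_components_mem E x, hd'⟩
  · rintro ⟨hC, hd⟩
    obtain ⟨x, -, rfl⟩ := exists_part_eq hC
    rw [← part_components_insert_of_disjoint hd]
    exact ⟨part_components_mem _ x, disjoint_part_components_insert_iff.2 hd⟩

theorem partsMeeting_of_mem (he : e ∈ E) (hx : x ∈ e) :
    (components E).partsMeeting e = {(components E).part x} := by
  rw [Finpartition.partsMeeting_eq_image _ (Finset.subset_univ e)]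
  ext C
  simp only [Finset.mem_image, Finset.mem_singleton]
  constructor
  · rintro ⟨y, hy, rfl⟩
    exact part_components_eq_iff.2 (Linked.of_mem he hy hx)
  · rintro rfl
    exact ⟨x, hx, rfl⟩

theorem partsAvoiding_of_mem (he : e ∈ E) (hx : x ∈ e) :
    (components E).partsAvoiding e = (components E).parts.erase ((components E).part x) := by
  rw [← Finpartition.parts_sdiff_partsMeeting, partsMeeting_of_mem he hx,
    Finset.sdiff_singleton_eq_erase]

theorem subset_part_components_iff (he : e ∈ E) (hx : x ∈ e) {C : Finset V}
    (hC : C ∈ (components E).parts) : e ⊆ C ↔ C = (components E).part x := by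
  constructor
  · exact fun h => ((components E).part_eq_of_mem hC (h hx)).symm
  · rintro rfl y hy
    exact mem_part_components.2 (Linked.of_mem he hx hy)

theorem card_partsMeeting_of_transverse (he : Transverse E e) :
    ((components E).partsMeeting e).card = e.card := by
  rw [Finpartition.partsMeeting_eq_image _ (Finset.subset_univ e)]
  exact Finset.card_image_of_injOn fun x hx y hy h => he x hx y hy (part_components_eq_iff.1 h)

theorem card_parts_components_insert (he : Transverse E e) (hne : e.Nonempty) :
    (components (insert e E)).parts.card + e.card = (components E).parts.card + 1 := by
  obtain ⟨x, hx⟩ := hne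
  have h1 := (components (insert e E)).sum_parts_eq_add e fun _ => 1
  have h2 := (components E).sum_parts_eq_add e fun _ => 1
  simp only [← Finset.card_eq_sum_ones] at h1 h2
  rw [h1, h2, partsMeeting_of_mem (Finset.mem_insert_self e E) hx,
    partsAvoiding_components_insert, card_partsMeeting_of_transverse he, Finset.card_singleton]
  ring

theorem sum_card_partsMeeting_insert (e : Finset V) (E : Finset (Finset V)) :
    ∑ C ∈ (components (insert e E)).partsMeeting e, C.card =
      ∑ C ∈ (components E).partsMeeting e, C.card := by
  have h1 := (components (insert e E)).sum_parts_eq_add e Finset.card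
  have h2 := (components E).sum_parts_eq_add e Finset.card
  rw [Finpartition.sum_card_parts] at h1 h2
  rw [partsAvoiding_components_insert] at h1
  omega

/-- A nonempty hyperedge lies in exactly one component, so choosing a component and a root hyperedge
in it amounts to choosing the hyperedge. -/
theorem sum_edgesIn_mul {R : Type*} [CommRing R] (hE : ∀ f ∈ E, f.Nonempty)
    (g : Finset (Finset V) → R) :
    ∑ C ∈ (components E).parts, (edgesIn E C : R) * g ((components E).parts.erase C) =
      ∑ f ∈ E, g ((components E).partsAvoiding f) := by
  have h : ∀ C ∈ (components E).parts,
      (edgesIn E C : R) * g ((components E).parts.erase C) =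
        ∑ f ∈ E, if f ⊆ C then g ((components E).parts.erase C) else 0 := fun C _ => by
    rw [← Finset.sum_filter, Finset.sum_const, nsmul_eq_mul, edgesIn]
  rw [Finset.sum_congr rfl h, Finset.sum_comm]
  refine Finset.sum_congr rfl fun f hf => ?_
  obtain ⟨x, hx⟩ := hE f hf
  rw [partsAvoiding_of_mem hf hx, Finset.sum_eq_single_of_mem _ (part_components_mem E x),
    if_pos ((subset_part_components_iff hf hx (part_components_mem E x)).2 rfl)]
  exact fun C hC hne => if_neg fun h => hne ((subset_part_components_iff hf hx hC).1 h)

theorem sum_edgesIn (hE : ∀ f ∈ E, f.Nonempty) :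
    ∑ C ∈ (components E).parts, (edgesIn E C : ℤ) = E.card := by
  have h := sum_edgesIn_mul (R := ℤ) hE fun _ => 1
  simpa using h

theorem part_components_empty (x : V) :
    (components (∅ : Finset (Finset V))).part x = {x} := by
  ext y
  rw [mem_part_components, linked_empty_iff, Finset.mem_singleton, eq_comm]

theorem card_of_mem_components_empty {C : Finset V}
    (hC : C ∈ (components (∅ : Finset (Finset V))).parts) : C.card = 1 := by
  obtain ⟨x, -, rfl⟩ := exists_part_eq hC
  rw [part_components_empty, Finset.card_singleton]

theorem card_eq_sum_of_forall {k : ℕ} (hE : ∀ f ∈ E, f.Nonempty)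
    (h : ∀ C ∈ (components E).parts, (C.card : ℤ) = 1 + (k - 1) * edgesIn E C) :
    (Fintype.card V : ℤ) = (components E).parts.card + (k - 1) * E.card := by
  rw [← Finset.card_univ, ← (components E).sum_card_parts, Nat.cast_sum, Finset.sum_congr rfl h,
    Finset.sum_add_distrib, ← Finset.mul_sum, sum_edgesIn hE]
  simp

/-- A component of a `k`-uniform hyperforest with `m` hyperedges has `1 + (k - 1) m` vertices. -/
theorem card_component {k : ℕ} (hk : 1 ≤ k) (hE : ∀ f ∈ E, f.card = k) (hac : Acyclic E) :
    ∀ C ∈ (components E).parts, (C.card : ℤ) = 1 + (k - 1) * edgesIn E C := by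
  induction E using Finset.induction_on with
  | empty =>
    intro C hC
    simp [card_of_mem_components_empty hC, edgesIn]
  | insert e E he ih =>
    obtain ⟨hacE, ht⟩ := (acyclic_insert_iff he).1 hac
    have hE' : ∀ f ∈ E, f.card = k := fun f hf => hE f (Finset.mem_insert_of_mem hf)
    have hec : e.card = k := hE e (Finset.mem_insert_self e E)
    have hne : ∀ f ∈ insert e E, f.Nonempty := fun f hf =>
      Finset.card_pos.1 (by rw [hE f hf]; omega)
    have hnE : ∀ f ∈ E, f.Nonempty := fun f hf => hne f (Finset.mem_insert_of_mem hf)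
    have hnee := hne e (Finset.mem_insert_self e E)
    have ih := ih hE' hacE
    obtain ⟨x, hx⟩ := hnee
    intro C hC
    by_cases hd : Disjoint C e
    · rw [edgesIn_insert_of_disjoint ⟨x, hx⟩ hd]
      refine ih C ?_
      have : C ∈ (components (insert e E)).partsAvoiding e := Finset.mem_filter.2 ⟨hC, hd⟩
      rw [partsAvoiding_components_insert] at this
      exact (Finset.mem_filter.1 this).1
    · have hCm : C ∈ (components (insert e E)).partsMeeting e := Finset.mem_filter.2 ⟨hC, hd⟩
      have hm := partsMeeting_of_mem (Finset.mem_insert_self e E) hx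
      rw [hm, Finset.mem_singleton] at hCm
      rw [← hCm] at hm
      -- The fused component is treated by subtraction: its size and edge count are the global
      -- totals minus the contributions of the avoiding components, where the induction hypothesis
      -- applies.
      have hn := card_eq_sum_of_forall hnE ih
      have hcard := card_parts_components_insert ht ⟨x, hx⟩
      have h1 := (components (insert e E)).sum_parts_eq_add e fun C => (C.card : ℤ)
      have h2 := (components (insert e E)).sum_parts_eq_add e fun C => (edgesIn (insert e E) C : ℤ)
      have h3 := (components (insert e E)).sum_parts_eq_add e fun _ => 1
      rw [← Nat.cast_sum, (components (insert e E)).sum_card_parts, Finset.card_univ, hm,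
        Finset.sum_singleton] at h1
      rw [sum_edgesIn hne, hm, Finset.sum_singleton, Finset.card_insert_of_notMem he] at h2
      rw [← Finset.card_eq_sum_ones, ← Finset.card_eq_sum_ones, ← Finset.card_eq_sum_ones, hm,
        Finset.card_singleton] at h3
      have hav : ∀ D ∈ (components (insert e E)).partsAvoiding e,
          (D.card : ℤ) = 1 + (k - 1) * edgesIn (insert e E) D := fun D hD => by
        rw [edgesIn_insert_of_disjoint ⟨x, hx⟩ (Finset.mem_filter.1 hD).2]
        rw [partsAvoiding_components_insert] at hD
        exact ih D (Finset.mem_filter.1 hD).1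
      rw [Finset.sum_congr rfl hav, Finset.sum_add_distrib, ← Finset.mul_sum] at h1
      simp only [Finset.sum_const, nsmul_eq_mul, mul_one] at h1
      rw [hec] at hcard
      push_cast at h2
      zify at hcard h3
      linear_combination hn - h1 - hcard + h3 + (k - 1 : ℤ) * h2

theorem card_eq_card_components_add {k : ℕ} (hk : 1 ≤ k) (hE : ∀ f ∈ E, f.card = k)
    (hac : Acyclic E) :
    Fintype.card V = (components E).parts.card + (k - 1) * E.card := by
  have h := card_eq_sum_of_forall (fun f hf => Finset.card_pos.1 (by rw [hE f hf]; omega))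
    (card_component hk hE hac)
  zify [hk]
  exact h

theorem numComponents_eq (G : FinHypergraph V) :
    G.numComponents = (components G.edges).parts.card := by
  have hrel : ∀ x y : V, G.connectedSetoid x y ↔
      (components G.edges).part x = (components G.edges).part y := fun x y =>
    nonempty_walk_iff_linked.trans part_components_eq_iff.symm
  have hbij : Function.Bijective (Quotient.lift
      (fun x : V => (⟨(components G.edges).part x, part_components_mem G.edges x⟩ :
        (components G.edges).parts))
      (fun x y h => Subtype.ext ((hrel x y).1 h)) :
      Quotient G.connectedSetoid → (components G.edges).parts) := by
    constructor
    · intro a b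
      induction a, b using Quotient.inductionOn₂ with
      | h x y => exact fun h => Quotient.sound ((hrel x y).2 (congrArg Subtype.val h))
    · rintro ⟨C, hC⟩
      obtain ⟨x, -, rfl⟩ := exists_part_eq hC
      exact ⟨Quotient.mk _ x, rfl⟩
  rw [numComponents, Nat.card_congr (Equiv.ofBijective _ hbij), Nat.card_eq_fintype_card,
    Fintype.card_coe]

end FinHypergraph

/-! ### Counting rooted hyperforests -/

namespace FinHypergraph

variable {V : Type*} [Fintype V] [DecidableEq V] {k p j : ℕ}

open Classical in
/-- The edge sets of the `k`-uniform hyperforests with `p` components. -/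
noncomputable def forests (V : Type*) [Fintype V] [DecidableEq V] (k p : ℕ) :
    Finset (Finset (Finset V)) :=
  (Finset.univ.powersetCard k).powerset.filter fun E =>
    Acyclic E ∧ (components E).parts.card = p

theorem mem_forests {E : Finset (Finset V)} :
    E ∈ forests V k p ↔
      (∀ f ∈ E, f.card = k) ∧ Acyclic E ∧ (components E).parts.card = p := by
  simp only [forests, Finset.mem_filter, Finset.mem_powerset, Finset.subset_iff,
    Finset.mem_powersetCard]
  simp

theorem nonempty_of_mem_forests (hk : 1 ≤ k) {E : Finset (Finset V)} (hE : E ∈ forests V k p) :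
    ∀ f ∈ E, f.Nonempty := fun f hf =>
  Finset.card_pos.1 (by rw [(mem_forests.1 hE).1 f hf]; omega)

/-- Removing a hyperedge from a forest leaves a forest to which the hyperedge is transverse. -/
theorem sum_forests_sum_mem {M : Type*} [AddCommMonoid M] (hk : 2 ≤ k)
    (g : Finset (Finset V) → Finset V → M) :
    ∑ E ∈ forests V k p, ∑ e ∈ E, g E e =
      ∑ E ∈ forests V k (p + (k - 1)),
        ∑ e ∈ (Finset.univ.powersetCard k).filter (fun e => (components E).SeparatesPoints e),
          g (insert e E) e := by
  rw [Finset.sum_sigma', Finset.sum_sigma']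
  have hins : ∀ (E : Finset (Finset V)) (e : Finset V), e ∉ E →
      (insert e E ∈ forests V k p ↔
        E ∈ forests V k (p + (k - 1)) ∧ e.card = k ∧ Transverse E e) := by
    intro E e he
    rw [mem_forests, mem_forests, acyclic_insert_iff he, Finset.forall_mem_insert]
    constructor
    · rintro ⟨⟨h1, h2⟩, ⟨h3, h4⟩, h5⟩
      have := card_parts_components_insert h4 (Finset.card_pos.1 (by omega))
      exact ⟨⟨h2, h3, by omega⟩, h1, h4⟩
    · rintro ⟨⟨h2, h3, h5⟩, h1, h4⟩
      have := card_parts_components_insert h4 (Finset.card_pos.1 (by omega))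
      exact ⟨⟨h1, h2⟩, ⟨h3, h4⟩, by omega⟩
  refine Finset.sum_bij' (fun q _ => ⟨q.1.erase q.2, q.2⟩) (fun q _ => ⟨insert q.2 q.1, q.2⟩)
    ?_ ?_ ?_ ?_ ?_
  · rintro ⟨E, e⟩ h
    simp only [Finset.mem_sigma] at h
    obtain ⟨hE, he⟩ := h
    rw [← Finset.insert_erase he] at hE
    obtain ⟨h1, h2, h3⟩ := (hins _ _ (Finset.notMem_erase e E)).1 hE
    simp only [Finset.mem_sigma, Finset.mem_filter, Finset.mem_powersetCard,
      separatesPoints_components_iff]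
    exact ⟨h1, ⟨Finset.subset_univ e, h2⟩, h3⟩
  · rintro ⟨E, e⟩ h
    simp only [Finset.mem_sigma, Finset.mem_filter, Finset.mem_powersetCard,
      separatesPoints_components_iff] at h ⊢
    obtain ⟨h1, ⟨-, h2⟩, h3⟩ := h
    exact ⟨(hins E e (h3.notMem (by omega))).2 ⟨h1, h2, h3⟩, Finset.mem_insert_self e E⟩
  · rintro ⟨E, e⟩ h
    simp only [Finset.mem_sigma] at h
    simp [Finset.insert_erase h.2]
  · rintro ⟨E, e⟩ h
    simp only [Finset.mem_sigma, Finset.mem_filter, Finset.mem_powersetCard,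
      separatesPoints_components_iff] at h
    obtain ⟨-, ⟨-, h2⟩, h3⟩ := h
    simp [Finset.erase_insert (h3.notMem (by omega))]
  · rintro ⟨E, e⟩ h
    simp only [Finset.mem_sigma] at h
    simp [Finset.insert_erase h.2]

/-- The number of hyperforests with `p` components, `j` of which are rooted at a hyperedge and
the others at a vertex. -/
noncomputable def markedForests (V : Type*) [Fintype V] [DecidableEq V] (k p j : ℕ) : ℂ :=
  ∑ E ∈ forests V k p, mixedSum (fun C => (C.card : ℂ)) (fun C => (edgesIn E C : ℂ)) j
    (components E).parts

/-- One of the `j + 1` root hyperedges is singled out and deleted. Its component breaks into `k`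
components rooted at its vertices; conversely, any `k` of the `p + (k - 1) - j` vertex-rooted
components can be joined along their roots. -/
theorem succ_mul_markedForests_succ (hk : 2 ≤ k) :
    ((j + 1 : ℕ) : ℂ) * markedForests V k p (j + 1) =
      (p + (k - 1) - j).choose k * markedForests V k (p + (k - 1)) j := by
  have h1 : ((j + 1 : ℕ) : ℂ) * markedForests V k p (j + 1) =
      ∑ E ∈ forests V k p, ∑ e ∈ E, mixedSum (fun C => (C.card : ℂ))
        (fun C => (edgesIn E C : ℂ)) j ((components E).partsAvoiding e) := by
    rw [markedForests, Finset.mul_sum]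
    refine Finset.sum_congr rfl fun E hE => ?_
    rw [succ_mul_mixedSum_succ, sum_edgesIn_mul (nonempty_of_mem_forests (by omega) hE)]
  rw [h1, sum_forests_sum_mem hk, markedForests, Finset.mul_sum]
  refine Finset.sum_congr rfl fun E hE => ?_
  rw [← (mem_forests.1 hE).2.2, ← sum_powersetCard_prod_mul_mixedSum,
    ← (components E).sum_transversals k fun S => mixedSum (fun C => (C.card : ℂ))
        (fun C => (edgesIn E C : ℂ)) j ((components E).parts \ S)]
  refine Finset.sum_congr rfl fun e he => ?_
  have hec := (Finset.mem_powersetCard.1 (Finset.mem_filter.1 he).1).2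
  rw [partsAvoiding_components_insert, Finpartition.parts_sdiff_partsMeeting]
  refine mixedSum_congr (fun _ _ => rfl) fun C hC => ?_
  rw [edgesIn_insert_of_disjoint (Finset.card_pos.1 (by omega)) (Finset.mem_filter.1 hC).2]

/-- The forest has `(n - p) / (k - 1)` hyperedges, with `n` the number of vertices; one is marked
and deleted. Rejoining a `k`-set `S` of components is possible in `∏_{C ∈ S} |C|` ways, and the new
component has `∑_{C ∈ S} |C|` possible roots. Together with the other roots this is `(∏ |C|) * ∑_{C
∈ S} |C|`, the product running over all components, and summing over `S` counts each component size
`choose (p + k - 2) (k - 1)` times, the sizes adding up to `n`. -/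
theorem sub_mul_markedForests_zero (hk : 2 ≤ k) :
    ((Fintype.card V : ℂ) - p) * markedForests V k p 0 =
      (k - 1 : ℕ) * (Fintype.card V * (p + (k - 1) - 1).choose (k - 1) *
        markedForests V k (p + (k - 1)) 0) := by
  have h1 : ((Fintype.card V : ℂ) - p) * markedForests V k p 0 = (k - 1 : ℕ) *
      ∑ E ∈ forests V k p, ∑ e ∈ E, ∏ C ∈ (components E).parts, (C.card : ℂ) := by
    rw [markedForests, Finset.mul_sum, Finset.mul_sum]
    refine Finset.sum_congr rfl fun E hE => ?_
    obtain ⟨h1, h2, h3⟩ := mem_forests.1 hE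
    have := card_eq_card_components_add (by omega) h1 h2
    rw [mixedSum_zero, this, h3, Finset.sum_const, nsmul_eq_mul]
    push_cast
    ring
  rw [h1, sum_forests_sum_mem hk fun E _ => ∏ C ∈ (components E).parts, (C.card : ℂ),
    markedForests]
  congr 1
  rw [Finset.mul_sum]
  refine Finset.sum_congr rfl fun E hE => ?_
  have h2 : ∀ e ∈ (Finset.univ.powersetCard k).filter
      (fun e => (components E).SeparatesPoints e),
      ∏ C ∈ (components (insert e E)).parts, (C.card : ℂ) =
        (∑ C ∈ (components E).partsMeeting e, (C.card : ℂ)) *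
          ∏ C ∈ (components E).parts \ (components E).partsMeeting e, (C.card : ℂ) := by
    intro e he
    obtain ⟨x, hx⟩ : e.Nonempty := Finset.card_pos.1
      (by rw [(Finset.mem_powersetCard.1 (Finset.mem_filter.1 he).1).2]; omega)
    rw [Finpartition.prod_parts_eq_mul _ e, partsAvoiding_components_insert,
      Finpartition.parts_sdiff_partsMeeting, ← Nat.cast_sum (R := ℂ),
      ← sum_card_partsMeeting_insert, partsMeeting_of_mem (Finset.mem_insert_self e E) hx,
      Finset.prod_singleton, Finset.sum_singleton]
  rw [Finset.sum_congr rfl h2, (components E).sum_transversals k fun S =>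
    (∑ C ∈ S, (C.card : ℂ)) * ∏ C ∈ (components E).parts \ S, (C.card : ℂ)]
  have h3 : ∀ S ∈ (components E).parts.powersetCard k,
      (∏ C ∈ S, (C.card : ℂ)) * ((∑ C ∈ S, (C.card : ℂ)) *
        ∏ C ∈ (components E).parts \ S, (C.card : ℂ)) =
      (∏ C ∈ (components E).parts, (C.card : ℂ)) * ∑ C ∈ S, (C.card : ℂ) := by
    intro S hS
    rw [← Finset.prod_sdiff (Finset.mem_powersetCard.1 hS).1]
    ring
  obtain ⟨l, rfl⟩ : ∃ l, k = l + 1 := ⟨k - 1, by omega⟩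
  rw [Finset.sum_congr rfl h3, ← Finset.mul_sum, Finset.sum_powersetCard_sum_mem_apply,
    (mem_forests.1 hE).2.2, mixedSum_zero, ← Nat.cast_sum, Finpartition.sum_card_parts,
    Finset.card_univ, Nat.add_sub_cancel]
  ring

theorem markedForests_card_zero (hk : 2 ≤ k) :
    markedForests V k (Fintype.card V) 0 = 1 := by
  have hcard : (components (∅ : Finset (Finset V))).parts.card = Fintype.card V := by
    have := card_eq_card_components_add (V := V) (E := ∅) (k := k) (by omega)
      (by simp) (by simp [Acyclic])
    simpa using this.symm
  have h : forests V k (Fintype.card V) = {∅} := by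
    ext E
    rw [mem_forests, Finset.mem_singleton]
    constructor
    · rintro ⟨h1, h2, h3⟩
      have := card_eq_card_components_add (by omega) h1 h2
      rw [h3] at this
      have h0 : (k - 1) * E.card = 0 := by omega
      rcases Nat.mul_eq_zero.1 h0 with h0 | h0
      · omega
      · exact Finset.card_eq_zero.1 h0
    · rintro rfl
      exact ⟨by simp, by simp [Acyclic], hcard⟩
  rw [markedForests, h, Finset.sum_singleton, mixedSum_zero]
  exact Finset.prod_eq_one fun C hC => by rw [card_of_mem_components_empty hC, Nat.cast_one]

theorem forests_eq_empty (hk : 2 ≤ k) (hp : ∀ m, Fintype.card V ≠ p + m * (k - 1)) :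
    forests V k p = ∅ := by
  refine Finset.eq_empty_of_forall_notMem fun E hE => ?_
  obtain ⟨h1, h2, h3⟩ := mem_forests.1 hE
  refine hp E.card ?_
  rw [card_eq_card_components_add (by omega) h1 h2, h3, mul_comm]

theorem forests_zero [Nonempty V] : forests V k 0 = ∅ := by
  refine Finset.eq_empty_of_forall_notMem fun E hE => ?_
  have h := Finset.card_eq_zero.1 (mem_forests.1 hE).2.2
  obtain ⟨x⟩ := ‹Nonempty V›
  exact absurd (part_components_mem E x) (by simp [h])

/-- The number of hyperforests all of whose components are rooted at vertices. -/
theorem markedForests_zero_mul (hk : 2 ≤ k) (m : ℕ) (hp : Fintype.card V = p + 1 + m * (k - 1)) :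
    markedForests V k (p + 1) 0 * ((m ! : ℂ) * ((k - 1)! : ℂ) ^ m * (p ! : ℂ)) =
      (Fintype.card V - 1)! * (Fintype.card V : ℂ) ^ m := by
  induction m generalizing p with
  | zero =>
    rw [Nat.zero_mul, Nat.add_zero] at hp
    rw [← hp, markedForests_card_zero hk, hp]
    simp
  | succ m ih =>
    obtain ⟨l, rfl⟩ : ∃ l, k = l + 2 := ⟨k - 2, by omega⟩
    have ih := ih (p := p + (l + 1)) (by rw [hp]; simp; ring)
    have hrec := sub_mul_markedForests_zero (V := V) (k := l + 2) (p := p + 1) hk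
    have h1 : l + 2 - 1 = l + 1 := rfl
    have h2 : p + 1 + (l + 1) = p + (l + 1) + 1 := by ring
    rw [h1, h2, Nat.add_sub_cancel] at hrec
    rw [h1] at ih ⊢
    have hch : (((p + (l + 1)).choose (l + 1) : ℕ) : ℂ) * ((l + 1)! * p !) = (p + (l + 1))! := by
      have := Nat.add_choose_mul_factorial_mul_factorial p (l + 1)
      exact_mod_cast (by linarith)
    have hl : ((l + 1 : ℕ) : ℂ) ≠ 0 := Nat.cast_ne_zero.2 (Nat.succ_ne_zero l)
    have hsub : (Fintype.card V : ℂ) - (p + 1 : ℕ) = (m + 1 : ℕ) * (l + 1 : ℕ) := by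
      rw [hp]
      push_cast
      ring
    rw [hsub] at hrec
    -- Since `n - (p + 1) = (m + 1)(k - 1)`, the factor `k - 1 = l + 1` cancels from the recursion.
    have hrec' : ((m + 1 : ℕ) : ℂ) * markedForests V (l + 2) (p + 1) 0 =
        Fintype.card V * (p + (l + 1)).choose (l + 1) *
          markedForests V (l + 2) (p + (l + 1) + 1) 0 := by
      refine mul_left_cancel₀ hl ?_
      linear_combination hrec
    rw [Nat.factorial_succ, pow_succ, pow_succ, Nat.cast_mul]
    linear_combination (m ! : ℂ) * ((l + 1)! : ℂ) ^ m * (l + 1)! * p ! * hrec' +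
      Fintype.card V * markedForests V (l + 2) (p + (l + 1) + 1) 0 * m ! * ((l + 1)! : ℂ) ^ m * hch
      + Fintype.card V * ih

/-- The hyperforests with hyperedge roots in terms of those with vertex roots only. -/
theorem markedForests_mul (hk : 2 ≤ k) (i j : ℕ) :
    markedForests V k (i + j) j * ((k ! : ℂ) ^ j * j ! * i !) =
      markedForests V k (i + k * j) 0 * (i + k * j)! := by
  -- The inductive step replaces `i` by `i + k` and needs `i + (j + 1) + (k - 1) = (i + k) + j`,
  -- which is not definitional; hence the separate variable `p`.
  suffices h : ∀ j p i : ℕ, p = i + j → markedForests V k p j * ((k ! : ℂ) ^ j * j ! * i !) =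
      markedForests V k (i + k * j) 0 * (i + k * j)! from h j _ i rfl
  intro j
  induction j with
  | zero =>
    rintro p i rfl
    simp
  | succ j ih =>
    rintro p i rfl
    have ih := ih (i + (j + 1) + (k - 1)) (i + k) (by omega)
    have hrec := succ_mul_markedForests_succ (V := V) (k := k) (p := i + (j + 1)) (j := j) hk
    have h1 : i + (j + 1) + (k - 1) - j = i + k := by omega
    have h2 : i + k + k * j = i + k * (j + 1) := by ring
    rw [h1] at hrec
    rw [h2] at ih
    have hch : (((i + k).choose k : ℕ) : ℂ) * (k ! * i !) = (i + k)! := by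
      have := Nat.add_choose_mul_factorial_mul_factorial i k
      exact_mod_cast (by linarith)
    rw [← ih, Nat.factorial_succ, pow_succ, Nat.cast_mul]
    linear_combination (k ! : ℂ) ^ j * k ! * j ! * i ! * hrec +
      markedForests V k (i + (j + 1) + (k - 1)) j * (k ! : ℂ) ^ j * j ! * hch

end FinHypergraph

/-! ### Coefficients of the generalized Hermite polynomials -/

/-- The pairs `(j, i)` with `i + k * j = s`. -/
def weightedAntidiagonal (k s : ℕ) : Finset (ℕ × ℕ) :=
  (Finset.range (s + 1) ×ˢ Finset.range (s + 1)).filter fun q => q.2 + k * q.1 = s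

theorem mem_weightedAntidiagonal {k s : ℕ} (hk : 1 ≤ k) {q : ℕ × ℕ} :
    q ∈ weightedAntidiagonal k s ↔ q.2 + k * q.1 = s := by
  simp only [weightedAntidiagonal, Finset.mem_filter, Finset.mem_product, Finset.mem_range,
    and_iff_right_iff_imp]
  intro h
  have := Nat.le_mul_of_pos_left q.1 hk
  omega

/-- Here `d = i + j` is the power of the exponent in the exponential series; `d ≤ s` because `j ≤ k
j`. -/
theorem sum_weightedAntidiagonal {M : Type*} [AddCommMonoid M] {k s : ℕ} (hk : 1 ≤ k)
    (f : ℕ × ℕ → M) :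
    ∑ q ∈ weightedAntidiagonal k s, f q =
      ∑ d ∈ Finset.range (s + 1), ∑ q ∈ Finset.HasAntidiagonal.antidiagonal d,
        if q.2 + k * q.1 = s then f q else 0 := by
  have hmaps : ∀ q ∈ weightedAntidiagonal k s, q.1 + q.2 ∈ Finset.range (s + 1) := fun q hq => by
    have h := (mem_weightedAntidiagonal hk).1 hq
    have := Nat.le_mul_of_pos_left q.1 hk
    rw [Finset.mem_range]
    omega
  rw [← Finset.sum_fiberwise_of_maps_to hmaps]
  refine Finset.sum_congr rfl fun d _ => ?_
  rw [← Finset.sum_filter]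
  refine Finset.sum_congr ?_ fun _ _ => rfl
  ext q
  simp only [Finset.mem_filter, mem_weightedAntidiagonal hk,
    Finset.HasAntidiagonal.mem_antidiagonal]
  exact and_comm

theorem coeff_genHermiteExponent_pow (k s d : ℕ) :
    PowerSeries.coeff s (genHermiteExponent k ^ d) =
      ∑ q ∈ Finset.HasAntidiagonal.antidiagonal d, if q.2 + k * q.1 = s then
        Polynomial.C ((d.choose q.1 : ℚ) * ((1 - (k : ℚ)) / (k ! : ℚ)) ^ q.1) *
          Polynomial.X ^ q.2 else 0 := by
  rw [genHermiteExponent, add_comm, (Commute.all _ _).add_pow', map_sum]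
  refine Finset.sum_congr rfl fun q _ => ?_
  have h : d.choose q.1 • ((PowerSeries.C (Polynomial.C ((1 - (k : ℚ)) / (k ! : ℚ))) *
      PowerSeries.X ^ k) ^ q.1 *
      (PowerSeries.C (Polynomial.X : Polynomial ℚ) * PowerSeries.X) ^ q.2) =
      PowerSeries.C (Polynomial.C ((d.choose q.1 : ℚ) * ((1 - (k : ℚ)) / (k ! : ℚ)) ^ q.1) *
        Polynomial.X ^ q.2) * PowerSeries.X ^ (q.2 + k * q.1) := by
    simp only [nsmul_eq_mul, mul_pow, map_mul, map_pow, map_natCast, pow_add, pow_mul]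
    ring
  rw [h, PowerSeries.coeff_C_mul, PowerSeries.coeff_X_pow]
  simp only [mul_ite, mul_one, mul_zero, eq_comm]

/-- The exponent has no constant term, so only its powers `d ≤ s` contribute to `z ^ s`. The
binomial theorem expands each, and `1 / d !` turns `d.choose j` into `1 / (j ! i !)`. -/
theorem genHermite_eq_sum {k : ℕ} (hk : 2 ≤ k) (s : ℕ) :
    genHermite k s = ∑ q ∈ weightedAntidiagonal k s,
      Polynomial.C ((s ! : ℚ) / (q.1 ! * q.2 !) * ((1 - (k : ℚ)) / (k ! : ℚ)) ^ q.1) *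
        Polynomial.X ^ q.2 := by
  have hsupp : (Function.support fun d : ℕ =>
      PowerSeries.coeff d (PowerSeries.exp (Polynomial ℚ)) •
        PowerSeries.coeff s (genHermiteExponent k ^ d)) ⊆ (Finset.range (s + 1) : Set ℕ) := by
    intro d hd
    rw [Finset.coe_range, Set.mem_Iio]
    by_contra hlt
    refine hd ?_
    simp only
    rw [coeff_genHermiteExponent_pow, Finset.sum_eq_zero, smul_zero]
    intro q hq
    rw [if_neg]
    rw [Finset.HasAntidiagonal.mem_antidiagonal] at hq
    have := Nat.le_mul_of_pos_left q.1 (show 0 < k by omega)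
    omega
  rw [genHermite, PowerSeries.coeff_subst' (hasSubst_genHermiteExponent hk),
    finsum_eq_sum_of_support_subset _ hsupp, sum_weightedAntidiagonal (by omega),
    Finset.smul_sum]
  refine Finset.sum_congr rfl fun d _ => ?_
  rw [coeff_genHermiteExponent_pow, Finset.smul_sum, Finset.smul_sum]
  refine Finset.sum_congr rfl fun q hq => ?_
  rw [smul_ite, smul_ite, smul_zero, smul_zero]
  refine if_congr Iff.rfl ?_ rfl
  rw [Finset.HasAntidiagonal.mem_antidiagonal] at hq
  rw [PowerSeries.coeff_exp, smul_eq_mul, Polynomial.smul_eq_C_mul, Polynomial.algebraMap_eq,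
    ← mul_assoc, ← mul_assoc, ← Polynomial.C_mul, ← Polynomial.C_mul]
  congr 2
  have hd : (d ! : ℚ) ≠ 0 := Nat.cast_ne_zero.2 (Nat.factorial_ne_zero d)
  have h1 : (q.1 ! : ℚ) ≠ 0 := Nat.cast_ne_zero.2 (Nat.factorial_ne_zero _)
  have h2 : (q.2 ! : ℚ) ≠ 0 := Nat.cast_ne_zero.2 (Nat.factorial_ne_zero _)
  have hch : (d.choose q.1 : ℚ) * q.1 ! * q.2 ! = d ! := by
    rw [← hq, Nat.choose_symm_add]
    exact_mod_cast Nat.add_choose_mul_factorial_mul_factorial q.1 q.2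
  generalize ((1 - (k : ℚ)) / (k ! : ℚ)) ^ q.1 = r
  field_simp
  linear_combination r * hch

/-- The generalized Hermite polynomials for `k = 2` are the Hermite polynomials. -/
theorem genHermite_two (s : ℕ) :
    genHermite 2 s = (Polynomial.hermite s).map (Int.castRingHom ℚ) := by
  rw [genHermite_eq_sum le_rfl]
  ext m
  simp only [Polynomial.finsetSum_coeff, Polynomial.coeff_C_mul, Polynomial.coeff_X_pow,
    Polynomial.coeff_map, mul_ite, mul_one, mul_zero]
  by_cases h : ∃ j, m + 2 * j = s
  · obtain ⟨j, rfl⟩ := h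
    rw [Finset.sum_eq_single_of_mem (j, m) ((mem_weightedAntidiagonal one_le_two).2 rfl),
      if_pos rfl, add_comm m, Polynomial.coeff_hermite_explicit]
    · have h1 : (j ! : ℚ) ≠ 0 := Nat.cast_ne_zero.2 (Nat.factorial_ne_zero _)
      have h2 : (m ! : ℚ) ≠ 0 := Nat.cast_ne_zero.2 (Nat.factorial_ne_zero _)
      have hch : ((2 * j + m).choose m : ℚ) * (2 * j)! * m ! = (2 * j + m)! := by
        exact_mod_cast Nat.add_choose_mul_factorial_mul_factorial (2 * j) m
      -- At `j = 0` the truncated `2 * j - 1` is `0`, and `0‼ = 1`.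
      have hdf : ((2 * j)! : ℚ) = 2 ^ j * j ! * (2 * j - 1)‼ := by
        cases j with
        | zero => simp
        | succ j =>
          have := Nat.factorial_eq_mul_doubleFactorial (2 * j + 1)
          rw [show 2 * j + 1 + 1 = 2 * (j + 1) by ring, Nat.doubleFactorial_two_mul] at this
          exact_mod_cast this
      have hpow : ((1 - ((2 : ℕ) : ℚ)) / ((2 ! : ℕ) : ℚ)) ^ j = (-1) ^ j / 2 ^ j := by
        rw [← div_pow]
        norm_num
      simp only [hpow]
      rw [← hch, hdf]
      rw [eq_intCast]
      push_cast
      field_simp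
    · rintro ⟨j', i⟩ hq hne
      rw [mem_weightedAntidiagonal one_le_two] at hq
      refine if_neg fun him => hne ?_
      simp only at hq him
      ext <;> simp only <;> omega
  · rw [Finset.sum_eq_zero, eq_comm, Polynomial.coeff_hermite]
    · split_ifs with he
      · rcases le_or_gt m s with hms | hms
        · exfalso
          obtain ⟨r, hr⟩ := he
          exact h ⟨r - m, by omega⟩
        · simp [Nat.choose_eq_zero_of_lt hms]
      · simp
    · rintro ⟨j, i⟩ hq
      rw [mem_weightedAntidiagonal one_le_two] at hq
      refine if_neg fun hmi => h ⟨j, ?_⟩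
      simp only at hq hmi
      omega

/-! ### Hermite polynomials as an Appell sequence -/

namespace Polynomial

theorem derivative_hermite_succ (n : ℕ) :
    derivative (hermite (n + 1)) = ((n + 1 : ℕ) : ℤ[X]) * hermite n := by
  induction n with
  | zero => simp
  | succ n ih =>
    rw [hermite_succ (n + 1), derivative_sub, derivative_mul, derivative_X, ih,
      derivative_natCast_mul, hermite_succ n]
    push_cast
    ring

theorem iterate_derivative_hermite (n p : ℕ) :
    derivative^[p] (hermite n) = (n.descFactorial p : ℤ[X]) * hermite (n - p) := by
  induction p with
  | zero => simp
  | succ p ih =>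
    rw [Function.iterate_succ_apply', ih, derivative_natCast_mul, Nat.descFactorial_succ]
    rcases Nat.eq_zero_or_pos (n - p) with h | h
    · simp [h]
    · obtain ⟨m, hm⟩ : ∃ m, n - p = m + 1 := ⟨n - p - 1, by omega⟩
      have hm' : n - (p + 1) = m := by omega
      rw [hm, hm', derivative_hermite_succ, Nat.cast_mul]
      ring

/-- Hasse derivatives are the Taylor coefficients, so this is the form that the expansion at `x`
requires. -/
theorem hasseDeriv_hermite (n p : ℕ) :
    hasseDeriv p (hermite n) = (n.choose p : ℤ[X]) * hermite (n - p) := by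
  have hp : ((p ! : ℕ) : ℤ[X]) ≠ 0 := Nat.cast_ne_zero.2 (Nat.factorial_ne_zero p)
  refine mul_left_cancel₀ hp ?_
  have h := congrFun (factorial_smul_hasseDeriv (R := ℤ) (k := p)) (hermite n)
  rw [iterate_derivative_hermite, Nat.descFactorial_eq_factorial_mul_choose] at h
  rw [← mul_assoc, ← Nat.cast_mul, ← h]
  simp [nsmul_eq_mul]

theorem map_hasseDeriv {R S : Type*} [Semiring R] [Semiring S] (f : R →+* S) (p : R[X]) (k : ℕ) :
    (hasseDeriv k p).map f = hasseDeriv k (p.map f) := by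
  ext n
  simp [hasseDeriv_coeff]

/-- The Hermite polynomials form an Appell sequence. -/
theorem aeval_add_hermite (n : ℕ) (x y : ℂ) :
    aeval (x + y) (hermite n) =
      ∑ p ∈ Finset.range (n + 1), (n.choose p : ℂ) * y ^ (n - p) * aeval x (hermite p) := by
  have h1 : aeval (x + y) (hermite n) =
      (taylor x ((hermite n).map (Int.castRingHom ℂ))).eval y := by
    rw [taylor_eval, add_comm y x, aeval_def, eval_map]
    rfl
  have hdeg : (taylor x ((hermite n).map (Int.castRingHom ℂ))).natDegree < n + 1 := by
    rw [natDegree_taylor]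
    exact Nat.lt_succ_of_le (natDegree_map_le.trans natDegree_hermite.le)
  rw [h1, eval_eq_sum_range' hdeg, ← Finset.sum_range_reflect]
  refine Finset.sum_congr rfl fun p hp => ?_
  have hp := Finset.mem_range_succ_iff.1 hp
  have hsub : n + 1 - 1 - p = n - p := by omega
  rw [hsub, taylor_coeff, ← map_hasseDeriv, hasseDeriv_hermite, Nat.choose_symm hp,
    Nat.sub_sub_self hp, Polynomial.map_mul, Polynomial.map_natCast, eval_mul, eval_natCast,
    eval_map, aeval_def]
  rw [show algebraMap ℤ ℂ = Int.castRingHom ℂ from rfl]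
  ring

end Polynomial

/-! ### From rooted forests to the two formulas -/

namespace FinHypergraph

theorem hyperforestGenFun_completeUniform {n k : ℕ} (hk : 2 ≤ k) (lam : ℂ) :
    (completeUniform n k hk).hyperforestGenFun lam =
      ∑ p ∈ Finset.range (n + 1), ∑ _E ∈ forests (Fin n) k p, lam ^ p := by
  have hmem : ∀ F : FinHypergraph (Fin n), F ∈ (completeUniform n k hk).spanningHyperforests ↔
      (∀ f ∈ F.edges, f.card = k) ∧ Acyclic F.edges := fun F => by
    rw [spanningHyperforests, Set.Finite.mem_toFinset, Set.mem_ofPred_eq,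
      isHyperforest_iff_acyclic]
    simp [completeUniform, Finset.subset_iff, Finset.mem_powersetCard]
  have hmaps : ∀ F ∈ (completeUniform n k hk).spanningHyperforests,
      F.numComponents ∈ Finset.range (n + 1) := fun F _ => by
    rw [Finset.mem_range, numComponents_eq, Nat.lt_succ_iff]
    simpa using (components F.edges).card_parts_le_card
  rw [hyperforestGenFun, ← Finset.sum_fiberwise_of_maps_to hmaps]
  refine Finset.sum_congr rfl fun p _ => ?_
  refine Finset.sum_bij (fun F _ => F.edges) ?_ ?_ ?_ ?_
  · intro F hF
    obtain ⟨hF, hp⟩ := Finset.mem_filter.1 hF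
    obtain ⟨h1, h2⟩ := (hmem F).1 hF
    exact mem_forests.2 ⟨h1, h2, numComponents_eq F ▸ hp⟩
  · exact fun F _ F' _ h => FinHypergraph.ext h
  · intro E hE
    obtain ⟨h1, h2, h3⟩ := mem_forests.1 hE
    refine ⟨⟨E, fun A hA => hk.trans_eq (h1 A hA).symm⟩, Finset.mem_filter.2 ⟨?_, ?_⟩, rfl⟩
    · exact (hmem _).2 ⟨h1, h2⟩
    · rw [numComponents_eq, h3]
  · intro F hF
    rw [(Finset.mem_filter.1 hF).2]

/-- Each component contributes `|C| + (1 - k) e(C) = 1`; the product over the components is expanded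
in powers of `1 - k`. -/
theorem card_forests_eq_sum_markedForests {V : Type*} [Fintype V] [DecidableEq V] {k : ℕ}
    (hk : 2 ≤ k) (p : ℕ) :
    ((forests V k p).card : ℂ) =
      ∑ j ∈ Finset.range (p + 1), (1 - (k : ℂ)) ^ j * markedForests V k p j := by
  simp_rw [markedForests, Finset.mul_sum]
  rw [Finset.sum_comm, Finset.card_eq_sum_ones, Nat.cast_sum]
  refine Finset.sum_congr rfl fun E hE => ?_
  obtain ⟨h1, h2, h3⟩ := mem_forests.1 hE
  rw [← h3, ← prod_add_mul_eq_sum_mixedSum, Nat.cast_one, eq_comm]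
  refine Finset.prod_eq_one fun C hC => ?_
  have h := congrArg (Int.cast : ℤ → ℂ) (card_component (by omega) h1 h2 C hC)
  push_cast at h
  rw [h]
  ring

/-- The summand of the pair `(j, i)`: the hyperforests with `j` components rooted at a hyperedge
and `i` components rooted at a vertex, each hyperedge root carrying the weight `1 - k`. -/
theorem weight_eq {V : Type*} [Fintype V] [DecidableEq V] {k : ℕ} (hk : 2 ≤ k) (i j : ℕ) :
    (1 - (k : ℂ)) ^ j * markedForests V k (i + j) j =
      markedForests V k (i + k * j) 0 *
        (((i + k * j)! : ℂ) / (j ! * i !) * ((1 - (k : ℂ)) / (k ! : ℂ)) ^ j) := by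
  have h := markedForests_mul (V := V) hk i j
  have h1 : (k ! : ℂ) ≠ 0 := Nat.cast_ne_zero.2 (Nat.factorial_ne_zero _)
  have h2 : (j ! : ℂ) ≠ 0 := Nat.cast_ne_zero.2 (Nat.factorial_ne_zero _)
  have h3 : (i ! : ℂ) ≠ 0 := Nat.cast_ne_zero.2 (Nat.factorial_ne_zero _)
  rw [div_pow]
  generalize (1 - (k : ℂ)) ^ j = r
  field_simp
  linear_combination r * h

/-- With `s = i + k j` the exponent of `μ` is `s + (k - 1) i = k (i + j)`, so only integral powers
of `lam` remain and the choice of root is immaterial. -/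
theorem pow_mul_aeval_genHermite {k : ℕ} (hk : 2 ≤ k) (s : ℕ) {lam μ : ℂ} (hμ : μ ^ k = lam) :
    μ ^ s * Polynomial.aeval (μ ^ (k - 1)) (genHermite k s) =
      ∑ q ∈ weightedAntidiagonal k s,
        (s ! : ℂ) / (q.1 ! * q.2 !) * ((1 - (k : ℂ)) / (k ! : ℂ)) ^ q.1 * lam ^ (q.2 + q.1) := by
  rw [genHermite_eq_sum hk, map_sum, Finset.mul_sum]
  refine Finset.sum_congr rfl fun q hq => ?_
  rw [mem_weightedAntidiagonal (by omega)] at hq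
  have hpow : μ ^ s * (μ ^ (k - 1)) ^ q.2 = lam ^ (q.2 + q.1) := by
    obtain ⟨l, rfl⟩ : ∃ l, k = l + 1 := ⟨k - 1, by omega⟩
    rw [← hμ, ← pow_mul, ← pow_mul, ← pow_add, ← hq, Nat.add_sub_cancel]
    congr 1
    ring
  rw [map_mul, map_pow, Polynomial.aeval_X, Polynomial.aeval_C, ← hpow]
  push_cast [eq_ratCast]
  ring

/-- The generating function of the hyperforests in terms of the rooted hyperforests and the
generalized Hermite polynomials. -/
theorem hyperforestGenFun_eq_sum_markedForests {n k : ℕ} (hk : 2 ≤ k) {lam μ : ℂ}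
    (hμ : μ ^ k = lam) :
    (completeUniform n k hk).hyperforestGenFun lam =
      ∑ s ∈ Finset.range (n + 1), markedForests (Fin n) k s 0 *
        (μ ^ s * Polynomial.aeval (μ ^ (k - 1)) (genHermite k s)) := by
  let g : ℕ × ℕ → ℂ := fun q => lam ^ (q.2 + q.1) *
    ((1 - (k : ℂ)) ^ q.1 * markedForests (Fin n) k (q.2 + q.1) q.1)
  have hL : (completeUniform n k hk).hyperforestGenFun lam =
      ∑ p ∈ Finset.range (n + 1), ∑ q ∈ Finset.HasAntidiagonal.antidiagonal p, g q := by
    rw [hyperforestGenFun_completeUniform]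
    refine Finset.sum_congr rfl fun p _ => ?_
    rw [Finset.sum_const, nsmul_eq_mul, card_forests_eq_sum_markedForests hk, mul_comm,
      Finset.mul_sum, Finset.Nat.sum_antidiagonal_eq_sum_range_succ_mk]
    refine Finset.sum_congr rfl fun j hj => ?_
    simp only [g, Nat.sub_add_cancel (Finset.mem_range_succ_iff.1 hj)]
  have hR : ∑ s ∈ Finset.range (n + 1), markedForests (Fin n) k s 0 *
        (μ ^ s * Polynomial.aeval (μ ^ (k - 1)) (genHermite k s)) =
      ∑ s ∈ Finset.range (n + 1), ∑ q ∈ weightedAntidiagonal k s, g q := by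
    refine Finset.sum_congr rfl fun s _ => ?_
    rw [pow_mul_aeval_genHermite hk s hμ, Finset.mul_sum]
    refine Finset.sum_congr rfl fun q hq => ?_
    rw [mem_weightedAntidiagonal (by omega)] at hq
    simp only [g]
    rw [weight_eq hk, hq]
    ring
  rw [hL, hR, Finset.sum_sigma', Finset.sum_sigma']
  symm
  -- The pairs `(j, i)` are regrouped from `i + k j` to `i + j`. The ranges do not match: pairs with
  -- `i + j ≤ n < i + k j` occur on one side only, but they vanish because no forest has more
  -- components than vertices.
  refine Finset.sum_bij_ne_zero (fun x _ _ => ⟨x.2.1 + x.2.2, x.2⟩) ?_ ?_ ?_ ?_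
  · rintro ⟨s, q⟩ h -
    simp only [Finset.mem_sigma, Finset.mem_range, mem_weightedAntidiagonal (show 1 ≤ k by omega),
      Finset.HasAntidiagonal.mem_antidiagonal, and_true] at h ⊢
    have := Nat.le_mul_of_pos_left q.1 (show 0 < k by omega)
    omega
  · rintro ⟨s, q⟩ h - ⟨s', q'⟩ h' - heq
    simp only [Finset.mem_sigma, mem_weightedAntidiagonal (show 1 ≤ k by omega)] at h h'
    simp only [Sigma.mk.injEq] at heq
    obtain ⟨-, heq⟩ := heq
    have heq := eq_of_heq heq
    subst heq
    rw [← h.2, ← h'.2]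
  · rintro ⟨p, q⟩ h hne
    simp only [Finset.mem_sigma, Finset.HasAntidiagonal.mem_antidiagonal] at h
    obtain ⟨-, rfl⟩ := h
    refine ⟨⟨q.2 + k * q.1, q⟩, ?_, hne, rfl⟩
    simp only [Finset.mem_sigma, Finset.mem_range, mem_weightedAntidiagonal (show 1 ≤ k by omega),
      and_true]
    by_contra hlt
    refine hne ?_
    simp only [g]
    rw [weight_eq hk, markedForests, forests_eq_empty hk, Finset.sum_empty, zero_mul, mul_zero]
    intro m
    rw [Fintype.card_fin]
    omega
  · intros
    rfl

theorem markedForests_zero_eq {n k p : ℕ} (hk : 2 ≤ k) (hp : 1 ≤ p) (hpn : p ≤ n)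
    (hdvd : (k - 1) ∣ (n - p)) :
    markedForests (Fin n) k p 0 =
      ((n - 1).choose (p - 1) : ℂ)
        * (((n - p)! : ℂ) /
            ((((n - p) / (k - 1))! : ℂ) * ((k - 1)! : ℂ) ^ ((n - p) / (k - 1))))
        * (n : ℂ) ^ ((n - p) / (k - 1)) := by
  obtain ⟨m, hm⟩ := hdvd
  obtain ⟨p, rfl⟩ : ∃ r, p = r + 1 := ⟨p - 1, by omega⟩
  have hdiv : (n - (p + 1)) / (k - 1) = m := by
    rw [hm, Nat.mul_div_cancel_left _ (by omega)]
  have h := markedForests_zero_mul (V := Fin n) (p := p) hk m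
    (by rw [Fintype.card_fin, mul_comm, ← hm]; omega)
  rw [Fintype.card_fin] at h
  have hch : ((n - 1).choose p : ℂ) * (p ! * (n - (p + 1))!) = (n - 1)! := by
    have := Nat.choose_mul_factorial_mul_factorial (show p ≤ n - 1 by omega)
    rw [show n - 1 - p = n - (p + 1) by omega] at this
    exact_mod_cast (by linarith)
  rw [hdiv, Nat.add_sub_cancel]
  have h1 : (m ! : ℂ) ≠ 0 := Nat.cast_ne_zero.2 (Nat.factorial_ne_zero _)
  have h2 : (p ! : ℂ) ≠ 0 := Nat.cast_ne_zero.2 (Nat.factorial_ne_zero _)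
  have h3 : ((k - 1)! : ℂ) ≠ 0 := Nat.cast_ne_zero.2 (Nat.factorial_ne_zero _)
  field_simp
  refine mul_left_cancel₀ h2 ?_
  linear_combination h - (n : ℂ) ^ m * hch

theorem hyperforestGenFun_eq_sum_genHermite {n k : ℕ} (hn : 1 ≤ n) (hk : 2 ≤ k) {lam μ : ℂ}
    (hμ : μ ^ k = lam) :
    (completeUniform n k hk).hyperforestGenFun lam =
      ∑ p ∈ (Finset.Icc 1 n).filter (fun p => (k - 1) ∣ (n - p)),
        ((n - 1).choose (p - 1) : ℂ)
          * (((n - p)! : ℂ) /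
              ((((n - p) / (k - 1))! : ℂ) * ((k - 1)! : ℂ) ^ ((n - p) / (k - 1))))
          * (n : ℂ) ^ ((n - p) / (k - 1))
          * μ ^ p * Polynomial.aeval (μ ^ (k - 1)) (genHermite k p) := by
  rw [hyperforestGenFun_eq_sum_markedForests hk hμ]
  symm
  refine (Finset.sum_congr rfl fun p hp => ?_).trans (Finset.sum_subset ?_ fun p hp hnp => ?_)
  · obtain ⟨hp, hdvd⟩ := Finset.mem_filter.1 hp
    obtain ⟨h1, h2⟩ := Finset.mem_Icc.1 hp
    rw [← markedForests_zero_eq hk h1 h2 hdvd, mul_assoc]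
  · intro p hp
    obtain ⟨-, h2⟩ := Finset.mem_Icc.1 (Finset.mem_filter.1 hp).1
    exact Finset.mem_range_succ_iff.2 h2
  · suffices h : forests (Fin n) k p = ∅ by rw [markedForests, h, Finset.sum_empty, zero_mul]
    have hpn := Finset.mem_range_succ_iff.1 hp
    rcases Nat.eq_zero_or_pos p with rfl | hp0
    · have : Nonempty (Fin n) := ⟨⟨0, hn⟩⟩
      exact forests_zero
    · refine forests_eq_empty hk fun m hm => hnp ?_
      rw [Fintype.card_fin] at hm
      exact Finset.mem_filter.2 ⟨Finset.mem_Icc.2 ⟨hp0, hpn⟩, m, by rw [mul_comm]; omega⟩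

theorem hyperforestGenFun_two_eq_hermite {n : ℕ} (hn : 1 ≤ n) {lam μ : ℂ} (hlam : lam ≠ 0)
    (hμ : μ ^ 2 = lam) :
    (completeUniform n 2 le_rfl).hyperforestGenFun lam =
      μ ^ n * (Polynomial.aeval (μ + n / μ) (Polynomial.hermite n)
        - (n / μ) * Polynomial.aeval (μ + n / μ) (Polynomial.hermite (n - 1))) := by
  have hμ0 : μ ≠ 0 := by
    rintro rfl
    exact hlam (by rw [← hμ, zero_pow two_ne_zero])
  obtain ⟨m, rfl⟩ : ∃ m, n = m + 1 := ⟨n - 1, by omega⟩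
  set y : ℂ := ((m + 1 : ℕ) : ℂ) / μ with hy
  -- Both Hermite values are expanded over the same range, the extra term `p = m + 1` vanishing
  -- here. Pascal's rule then leaves `m.choose (p - 1)` for `p ≥ 1`, while `μ ^ n * y ^ (n - p) = n
  -- ^ (n - p) * μ ^ p` with `n = m + 1`; these are the rooted forest counts for `k = 2`.
  have hlow : y * Polynomial.aeval (μ + y) (Polynomial.hermite m) =
      ∑ p ∈ Finset.range (m + 1 + 1),
        (m.choose p : ℂ) * y ^ (m + 1 - p) * Polynomial.aeval μ (Polynomial.hermite p) := by
    rw [Polynomial.aeval_add_hermite, Finset.mul_sum, Finset.sum_range_succ _ (m + 1),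
      Nat.choose_succ_self, Nat.cast_zero, zero_mul, zero_mul, add_zero]
    refine Finset.sum_congr rfl fun p hp => ?_
    rw [Nat.succ_sub (Finset.mem_range_succ_iff.1 hp), pow_succ]
    ring
  have hzero : markedForests (Fin (m + 1)) 2 0 0 = 0 := by
    rw [markedForests, forests_zero, Finset.sum_empty]
  rw [hyperforestGenFun_eq_sum_markedForests le_rfl hμ, Nat.add_sub_cancel, hlow,
    Polynomial.aeval_add_hermite, ← Finset.sum_sub_distrib, Finset.mul_sum,
    Finset.sum_range_succ' _ (m + 1), Finset.sum_range_succ' _ (m + 1), hzero]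
  simp only [Nat.choose_zero_right, sub_self, mul_zero, zero_mul, add_zero]
  refine Finset.sum_congr rfl fun q hq => ?_
  have hq := Finset.mem_range_succ_iff.1 hq
  rw [markedForests_zero_eq (n := m + 1) (p := q + 1) le_rfl (Nat.le_add_left 1 q)
    (Nat.succ_le_succ hq) (one_dvd _),
    genHermite_two, Nat.choose_succ_succ]
  have hH : Polynomial.aeval (μ ^ (2 - 1))
      ((Polynomial.hermite (q + 1)).map (Int.castRingHom ℚ)) =
      Polynomial.aeval μ (Polynomial.hermite (q + 1)) := by
    rw [show 2 - 1 = 1 from rfl, pow_one]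
    exact Polynomial.aeval_map_algebraMap ℚ μ (Polynomial.hermite (q + 1))
  have hfac : (((m - q)! : ℕ) : ℂ) ≠ 0 := Nat.cast_ne_zero.2 (Nat.factorial_ne_zero _)
  have hpow : μ ^ (m + 1) = μ ^ (m - q) * μ ^ (q + 1) := by
    rw [← pow_add]
    congr 1
    omega
  rw [hH, hy, div_pow, hpow, show 2 - 1 = 1 from rfl, Nat.add_sub_add_right, Nat.div_one]
  simp only [Nat.add_sub_cancel, Nat.sub_zero, Nat.factorial_one, Nat.cast_one, one_pow, mul_one]
  push_cast
  field_simp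
  ring

end FinHypergraph

theorem mainTheorem5 :
    (∀ (n k : ℕ) (_ : 1 ≤ n) (hk : 2 ≤ k) (lam μ : ℂ) (_ : μ ^ k = lam),
      (FinHypergraph.completeUniform n k hk).hyperforestGenFun lam =
        ∑ p ∈ (Finset.Icc 1 n).filter (fun p => (k - 1) ∣ (n - p)),
          ((n - 1).choose (p - 1) : ℂ)
            * (((n - p)! : ℂ) /
                ((((n - p) / (k - 1))! : ℂ) * ((k - 1)! : ℂ) ^ ((n - p) / (k - 1))))
            * (n : ℂ) ^ ((n - p) / (k - 1))
            * μ ^ p * Polynomial.aeval (μ ^ (k - 1)) (genHermite k p)) ∧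
    (∀ (n : ℕ) (_ : 1 ≤ n) (lam μ : ℂ) (_ : lam ≠ 0) (_ : μ ^ 2 = lam),
      (FinHypergraph.completeUniform n 2 le_rfl).hyperforestGenFun lam =
        μ ^ n * (Polynomial.aeval (μ + n / μ) (Polynomial.hermite n)
          - (n / μ) * Polynomial.aeval (μ + n / μ) (Polynomial.hermite (n - 1)))) := by
  exact ⟨fun _ _ hn hk _ _ hμ => FinHypergraph.hyperforestGenFun_eq_sum_genHermite hn hk hμ,
    fun _ hn _ _ hlam hμ => FinHypergraph.hyperforestGenFun_two_eq_hermite hn hlam hμ⟩
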